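/- Let $p\ge 1$, $T\ge 2$. For individuals $i=1,2,\dots$ let $y_{it}$ ($-p+1\le t\le T$) and the $K$-vectors $x_{it}=(x_{itk})_k$ ($1\le t\le T$) be random variables on a probability space with $$y_{it}=\sum_{j=1}^p\delta_{0j}\,y_{i,t-j}+x_{it}'\beta_0+e_{it},\qquad t=1,\dots,T ,$$ and let $x_i$ be the vector of all distinct entries of $x_{i1},\dots,x_{iT}$. Put $\Delta y_{it}=y_{it}-y_{i,t-1}$, and similarly $\Delta x_{it}$, $\Delta e_{it}$; let $\Delta e_i=(\Delta e_{i2},\dots,\Delta e_{iT})'$, and assume that the differenced errors are centered, $E(\Delta e_i)=0$. For $j=1,\dots,p$ put $\theta_{0,p+1-j}=\mathrm{Var}(x_i)^{-1}\mathrm{Cov}(x_i,\Delta y_{i,2-j})$ and $\mu_{0,p+1-j}=E(\Delta y_{i,2-j})-E(x_i)'\theta_{0,p+1-j}$, and let $r_{i,p+1-j}=\Delta y_{i,2-j}-\mu_{0,p+1-j}-x_i'\theta_{0,p+1-j}$ be the residual of the linear projection of $\Delta y_{i,2-j}$ on $(1,x_i)$. Let $\widetilde u_i=(r_{i1},\dots,r_{ip},\Delta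 e_i')'$ and $\widetilde y_i=(\Delta y_{i,-p+2},\dots,\Delta y_{i1},\Delta y_{i2},\dots,\Delta y_{iT})'$. Let $$\widetilde W_i=\begin{pmatrix}0&0&I_p\otimes(1,x_i')\\ \Delta Y_i&\Delta X_i&0\end{pmatrix},$$ where the row of $(\Delta Y_i,\Delta X_i)$ for period $t=2,\dots,T$ is $(\Delta y_{i,t-1},\dots,\Delta y_{i,t-p},\Delta x_{it}')$. For $\eta=(\delta',\beta',\mu_1,\theta_1',\dots,\mu_p,\theta_p')'$ and a symmetric matrix $\Upsilon$ of order $T+p-1$ put $\lambda=(\eta',\mathrm{vech}(\Upsilon)')'$, $\widetilde u_i(\eta)=\widetilde y_i-\widetilde W_i\eta$, $$\widetilde l_i(\lambda)=-\tfrac{T+p-1}{2}\ln(2\pi)-\tfrac12\ln|\Upsilon|-\tfrac12\,\widetilde u_i(\eta)'\Upsilon^{-1}\widetilde u_i(\eta),\qquad \widetilde L_N=\frac1N\sum_{i=1}^N\widetilde l_i,\qquad \widetilde H_N=\frac{\partial^2\widetilde L_N}{\partial\lambda\,\partial\lambda'},$$ and let $\Lambda=\{\lambda:\Upsilon\text{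 is positive definite}\}$. Theorem 3. Assume: (C1) for some $\epsilon>0$ and $M<\infty$, $E|y_{it}|^{2+\epsilon}<M$ and $E|x_{itk}|^{2+\epsilon}<M$ for all $i,t,k$; (C2′) $\mathrm{Var}(x_i)=\Xi_{xx}$ is positive definite and does not depend on $i$; $E(x_i)$ and, for $j=1,\dots,p$, $E(\Delta y_{i,2-j})$ and $E(x_i\,\Delta y_{i,2-j})$ do not depend on $i$; and $\mathrm{Cov}(x_i,\Delta e_i)=0$; (C3′) $E(\widetilde u_i\widetilde u_i')=\Upsilon_0$ for all $i$, with $\Upsilon_0$ positive definite; (C4) the limits as $N\to\infty$ of $N^{-1}\sum_{i\le N}E(y_{is}y_{it})$, $N^{-1}\sum_{i\le N}E(y_{is}x_{itk})$ and $N^{-1}\sum_{i\le N}E(x_{isj}x_{itk})$ exist for all $s,t,j,k$; (C5) the vectors consisting of $x_i$ and of $y_{it}$, $-p+1\le t\le T$, are independent across $i$. Let $\lambda_0=(\eta_0',\mathrm{vech}(\Upsilon_0)')'$ with $\eta_0=(\delta_0',\beta_0',\mu_{01},\theta_{01}',\dots,\mu_{0p},\theta_{0p}')'$. Then $\widetilde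 L_N$ is twice continuously differentiable on $\Lambda$ and $E[\partial\widetilde L_N(\lambda_0)/\partial\lambda]=0$ for every $N$. Furthermore, for every $\lambda\in\Lambda$ the limit $\widetilde H(\lambda)=\lim_{N\to\infty}E[\widetilde H_N(\lambda)]$ exists, and $\widetilde H_N(\lambda)\to\widetilde H(\lambda)$ almost surely. Moreover, if $\widetilde H(\lambda_0)$ is negative definite, then there are a compact set $\overline\Lambda\subset\Lambda$ with $\lambda_0$ in its interior and, for every $N$, a measurable maximizer $\widehat\lambda=\widehat\lambda_N$ of $\widetilde L_N$ over $\overline\Lambda$, such that $\widehat\lambda_N\to\lambda_0$ almost surely as $N\to\infty$ with $T$ fixed. -/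

import Mathlib

open MeasureTheory ProbabilityTheory Filter Topology Matrix

noncomputable section

namespace DiffQML

/-- Panel data on a sample space `Ω`. Individuals are indexed by `i : ℕ`, time by `t : ℤ`.
`y i t` is the dependent variable (observed for `1 - p ≤ t ≤ T`), `x i` is the vector of the `q`
distinct regressor variables of individual `i`, and `e i t` is the regression error
(for `1 ≤ t ≤ T`). The `k`-th regressor in period `t` is the entry number `loc t k` of `x i`. -/
structure Panel (Ω : Type*) (K q : ℕ) where
  y : ℕ → ℤ → Ω → ℝ
  x : ℕ → Fin q → Ω → ℝ
  e : ℕ → ℤ → Ω → ℝ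
  loc : ℤ → Fin K → Fin q

/-- Coordinates of the regression parameter `η = (δ', β', μ₁, θ₁', …, μ_p, θ_p')'`:
`δ_j`, then `β_k`, then for each initial difference the intercept and the slopes. -/
abbrev EtaIdx (p K q : ℕ) : Type := Fin p ⊕ Fin K ⊕ Fin p × (Unit ⊕ Fin q)

/-- Positions on and below the diagonal of an `n × n` matrix. -/
abbrev VechIdx (n : ℕ) : Type := {ab : Fin n × Fin n // ab.2 ≤ ab.1}

/-- Coordinates of `λ = (η', vech(Υ)')'`, with `Υ` of size `p + T - 1`. -/
abbrev ParamIdx (p T K q : ℕ) : Type := EtaIdx p K q ⊕ VechIdx (p + T - 1)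

/-- The Euclidean space of all parameter vectors `λ`. -/
abbrev Param (p T K q : ℕ) : Type := EuclideanSpace ℝ (ParamIdx p T K q)

/-- The half-vectorization of a square matrix. -/
def vech {n : ℕ} (A : Matrix (Fin n) (Fin n) ℝ) : VechIdx n → ℝ := fun ab => A ab.1.1 ab.1.2

/-- The symmetric matrix with a given half-vectorization. -/
def unvech {n : ℕ} (v : VechIdx n → ℝ) : Matrix (Fin n) (Fin n) ℝ :=
  Matrix.of fun a b => if h : b ≤ a then v ⟨(a, b), h⟩ else v ⟨(b, a), (not_le.mp h).le⟩

/-- The part `η` of `λ`. -/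
def etaOf {p T K q : ℕ} (lam : Param p T K q) : EtaIdx p K q → ℝ := fun c => lam (Sum.inl c)

/-- The matrix `Υ` encoded in `λ`. -/
def upsOf {p T K q : ℕ} (lam : Param p T K q) : Matrix (Fin (p + T - 1)) (Fin (p + T - 1)) ℝ :=
  unvech fun ab => lam (Sum.inr ab)

/-- The parameter space: all `λ` whose matrix `Υ` is positive definite. -/
def ParamSpace (p T K q : ℕ) : Set (Param p T K q) := {lam | (upsOf lam).PosDef}

/-- The parameter vector `λ` with components `δ`, `β`, `μ`, `θ` and `vech Υ`. -/
def mkParam {p T K q : ℕ} (δ : Fin p → ℝ) (β : Fin K → ℝ) (μ : Fin p → ℝ)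
    (θ : Fin p → Fin q → ℝ) (Υ : Matrix (Fin (p + T - 1)) (Fin (p + T - 1)) ℝ) :
    Param p T K q :=
  WithLp.toLp 2 (Sum.elim
    (Sum.elim δ (Sum.elim β fun mc => Sum.elim (fun _ => μ mc.1) (fun l => θ mc.1 l) mc.2))
    (vech Υ))

/-- The period of row `a` (counted from `0`) of the system: the rows belong to the periods
`-p + 2, …, 1, 2, …, T`. -/
def rowTime (p : ℕ) (a : ℕ) : ℤ := (a : ℤ) - p + 2

namespace Panel

variable {Ω : Type*} {K q : ℕ} (D : Panel Ω K q)

/-- The `k`-th regressor of individual `i` in period `t`. -/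
def xt (i : ℕ) (t : ℤ) (k : Fin K) (ω : Ω) : ℝ := D.x i (D.loc t k) ω

/-- `Δy_{it} = y_{it} - y_{i,t-1}`. -/
def dy (i : ℕ) (t : ℤ) (ω : Ω) : ℝ := D.y i t ω - D.y i (t - 1) ω

/-- `Δx_{itk} = x_{itk} - x_{i,t-1,k}`. -/
def dx (i : ℕ) (t : ℤ) (k : Fin K) (ω : Ω) : ℝ := D.xt i t k ω - D.xt i (t - 1) k ω

/-- `Δe_{it} = e_{it} - e_{i,t-1}`. -/
def de (i : ℕ) (t : ℤ) (ω : Ω) : ℝ := D.e i t ω - D.e i (t - 1) ω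

/-- The dynamic panel data model of order `p` in the periods `1, …, T`:
`y_{it} = ∑_j δ_j y_{i,t-j} + ∑_k β_k x_{itk} + e_{it}`. -/
def Model (p T : ℕ) (δ : Fin p → ℝ) (β : Fin K → ℝ) : Prop :=
  ∀ i : ℕ, ∀ t ∈ Set.Icc (1 : ℤ) T, ∀ ω,
    D.y i t ω = ∑ j : Fin p, δ j * D.y i (t - ((j : ℤ) + 1)) ω
      + ∑ k : Fin K, β k * D.xt i t k ω + D.e i t ω

/-- The left-hand side `ỹ_i` of the differenced system. -/
def yTilde (p T : ℕ) (i : ℕ) (ω : Ω) : Fin (p + T - 1) → ℝ := fun a => D.dy i (rowTime p a) ω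

/-- The regressor matrix `W̃_i` of the differenced system. Its first `p` rows are
`(0, 0, I_p ⊗ (1, x_i'))`, the others are the rows of `(ΔY_i, ΔX_i, 0)`. -/
def wTilde (p T : ℕ) (i : ℕ) (ω : Ω) : Matrix (Fin (p + T - 1)) (EtaIdx p K q) ℝ :=
  Matrix.of fun a c =>
    match c with
    | Sum.inl j => if (a : ℕ) < p then 0 else D.dy i (rowTime p a - ((j : ℤ) + 1)) ω
    | Sum.inr (Sum.inl k) => if (a : ℕ) < p then 0 else D.dx i (rowTime p a) k ω
    | Sum.inr (Sum.inr (m, Sum.inl _)) => if (a : ℕ) = m then 1 else 0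
    | Sum.inr (Sum.inr (m, Sum.inr l)) => if (a : ℕ) = m then D.x i l ω else 0

/-- `ũ_i(η) = ỹ_i - W̃_i η`. -/
def resid (p T : ℕ) (i : ℕ) (η : EtaIdx p K q → ℝ) (ω : Ω) : Fin (p + T - 1) → ℝ :=
  D.yTilde p T i ω - D.wTilde p T i ω *ᵥ η

/-- The quasi log-likelihood contribution `l̃_i(λ)` of individual `i`. -/
def qll (p T : ℕ) (i : ℕ) (ω : Ω) (lam : Param p T K q) : ℝ :=
  -(((T : ℝ) + p - 1) / 2) * Real.log (2 * Real.pi) - 1 / 2 * Real.log (upsOf lam).det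
    - 1 / 2 * (D.resid p T i (etaOf lam) ω ⬝ᵥ ((upsOf lam)⁻¹ *ᵥ D.resid p T i (etaOf lam) ω))

/-- The average quasi log-likelihood `L̃_N(λ)` of the first `N` individuals. -/
def avgQll (p T : ℕ) (N : ℕ) (ω : Ω) (lam : Param p T K q) : ℝ :=
  (N : ℝ)⁻¹ * ∑ i ∈ Finset.range N, D.qll p T i ω lam

/-- The Hessian `H̃_N(λ)`: the matrix of second partial derivatives of `L̃_N`. -/
def avgHessian (p T : ℕ) (N : ℕ) (ω : Ω) (lam : Param p T K q) :
    Matrix (ParamIdx p T K q) (ParamIdx p T K q) ℝ :=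
  Matrix.of fun a b =>
    fderiv ℝ (fun v => fderiv ℝ (D.avgQll p T N ω) v (EuclideanSpace.single b 1)) lam
      (EuclideanSpace.single a 1)

variable [MeasurableSpace Ω] (P : Measure Ω)

/-- `Var(x_i)`. -/
def varX (i : ℕ) : Matrix (Fin q) (Fin q) ℝ := Matrix.of fun a b => cov[D.x i a, D.x i b; P]

/-- The slope `Var(x_i)⁻¹ Cov(x_i, Δy_{it})` of the linear projection of `Δy_{it}` on
`(1, x_i)`. -/
def projSlope (i : ℕ) (t : ℤ) : Fin q → ℝ :=
  (D.varX P i)⁻¹ *ᵥ fun l => cov[D.x i l, D.dy i t; P]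

/-- The intercept `E(Δy_{it}) - E(x_i)' Var(x_i)⁻¹ Cov(x_i, Δy_{it})` of that projection. -/
def projIntercept (i : ℕ) (t : ℤ) : ℝ :=
  (∫ ω, D.dy i t ω ∂P) - (fun l => ∫ ω, D.x i l ω ∂P) ⬝ᵥ D.projSlope P i t

/-- The error vector `ũ_i = (r_{i1}, …, r_{ip}, Δe_{i2}, …, Δe_{iT})'` of the differenced system,
where `r_{i,m}` is the residual of the linear projection of the `m`-th initial difference
on `(1, x_i)`. -/
def sysError (p T : ℕ) (i : ℕ) (ω : Ω) : Fin (p + T - 1) → ℝ := fun a =>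
  if (a : ℕ) < p then
    D.dy i (rowTime p a) ω - D.projIntercept P i (rowTime p a)
      - (fun l => D.x i l ω) ⬝ᵥ D.projSlope P i (rowTime p a)
  else D.de i (rowTime p a) ω

/-- Uniformly bounded absolute moments of some order `2 + ε`. -/
def MomentBound (p T : ℕ) : Prop :=
  ∃ ε > (0 : ℝ), ∃ M : ℝ,
    (∀ i : ℕ, ∀ t ∈ Set.Icc (1 - (p : ℤ)) T,
      Integrable (fun ω => |D.y i t ω| ^ (2 + ε)) P ∧ ∫ ω, |D.y i t ω| ^ (2 + ε) ∂P < M) ∧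
    (∀ i : ℕ, ∀ t ∈ Set.Icc (1 : ℤ) T, ∀ k : Fin K,
      Integrable (fun ω => |D.xt i t k ω| ^ (2 + ε)) P ∧ ∫ ω, |D.xt i t k ω| ^ (2 + ε) ∂P < M)

/-- Homogeneity of the moments that define the linear projections, and exogeneity of the
regressors with respect to the differenced errors. -/
structure ProjectionMoments (p T : ℕ) : Prop where
  var_x : ∃ Ξ : Matrix (Fin q) (Fin q) ℝ, Ξ.PosDef ∧ ∀ i, D.varX P i = Ξ
  mean_x : ∃ m : Fin q → ℝ, ∀ i l, ∫ ω, D.x i l ω ∂P = m l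
  mean_dy : ∃ m : Fin p → ℝ, ∀ (i : ℕ) (j : Fin p), ∫ ω, D.dy i (2 - ((j : ℤ) + 1)) ω ∂P = m j
  mean_x_dy : ∃ ρ : Fin p → Fin q → ℝ, ∀ (i : ℕ) (j : Fin p) (l : Fin q),
    ∫ ω, D.x i l ω * D.dy i (2 - ((j : ℤ) + 1)) ω ∂P = ρ j l
  cov_x_de : ∀ (i : ℕ) (l : Fin q), ∀ t ∈ Set.Icc (2 : ℤ) T, cov[D.x i l, D.de i t; P] = 0

/-- Existence of the limits of the averaged second moments of the data. -/
structure MomentLimits (p T : ℕ) : Prop where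
  lim_yy : ∀ s ∈ Set.Icc (1 - (p : ℤ)) T, ∀ t ∈ Set.Icc (1 - (p : ℤ)) T, ∃ c : ℝ,
    Tendsto (fun N : ℕ => (N : ℝ)⁻¹ * ∑ i ∈ Finset.range N, ∫ ω, D.y i s ω * D.y i t ω ∂P)
      atTop (𝓝 c)
  lim_yx : ∀ s ∈ Set.Icc (1 - (p : ℤ)) T, ∀ t ∈ Set.Icc (1 : ℤ) T, ∀ k : Fin K, ∃ c : ℝ,
    Tendsto (fun N : ℕ => (N : ℝ)⁻¹ * ∑ i ∈ Finset.range N, ∫ ω, D.y i s ω * D.xt i t k ω ∂P)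
      atTop (𝓝 c)
  lim_xx : ∀ s ∈ Set.Icc (1 : ℤ) T, ∀ t ∈ Set.Icc (1 : ℤ) T, ∀ j k : Fin K, ∃ c : ℝ,
    Tendsto (fun N : ℕ => (N : ℝ)⁻¹ * ∑ i ∈ Finset.range N, ∫ ω, D.xt i s j ω * D.xt i t k ω ∂P)
      atTop (𝓝 c)

/-- All observations on individual `i`: the vector `x_i` and `y_{it}` for `1 - p ≤ t ≤ T`. -/
def obs (p T : ℕ) (i : ℕ) (ω : Ω) : (Fin q → ℝ) × (Set.Icc (1 - (p : ℤ)) (T : ℤ) → ℝ) :=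
  (fun l => D.x i l ω, fun t => D.y i t ω)

end Panel

end DiffQML

end

/-!
The quasi log-likelihood depends on the data of individual `i` only through the cross products of
the variables `(ỹ_i, W̃_i)` of the differenced system, and it is linear in them:
`l̃_i(λ) = ∑_j z_{ij} φ_j(λ)` (`Panel.qll_eq_sum`), with coefficient functions `φ_j` that are smooth
where `Υ` is positive definite. Hence the average likelihood, its gradient and its Hessian are
linear combinations of fixed functions of `λ`, and everything probabilistic concerns the finitely
many averages `z̄_{Nj}` (`Panel.avgCross`).

*Convergence of the averages.* The variables of the system are linear combinations of
`1`, the `Δy_{it}` and the entries of `x_i` (`Panel.augReg_mem_span`), so their products have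
uniformly bounded moments of some order above one. A strong law for independent, not identically
distributed variables (`strong_law_of_moment`: truncation, Kolmogorov's convergence theorem through
martingale convergence, Kronecker's lemma) gives `z̄_N - E z̄_N → 0` almost surely. The limits of
`E z̄_N` are assumed for products of levels; for products with the constant they exist because the
recursion of the model makes `E Δy_{it}` the same for all individuals
(`Panel.exists_integral_dy_eq`).

*Expected score.* At `λ₀` the residuals are the errors `ũ_i`, which are centered and orthogonal to
`x_i`. In the direction of `Υ` the expected likelihood is `-½ (ln |Υ| + tr (Υ⁻¹ Υ₀))` up to a
constant, which is stationary at `Υ₀` (`hasDerivAt_log_det_add_trace`). In the direction of a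
coefficient of `η` the derivative is `tr (Υ₀⁻¹ E(ũ w'))` for a column `w` of `W̃`. Columns made of
`1` and `x` contribute nothing. For a lag, the recursion gives `E(ỹ ũ') = G Υ₀` with `G` lower
triangular (`Panel.exists_integral_dy_mul_sysError`), so the trace is that of a strictly lower
triangular matrix (`Panel.sum_inv_mul_integral_augReg`).

*Consistency.* The limit function `∑_j m_j φ_j` is stationary at `λ₀` and has Hessian `H(λ₀)`
there, so if that is negative definite, `λ₀` is the unique maximizer on a small closed ball
(`exists_lt_on_closedBall`). Maximizers of `∑_j z̄_{Nj} φ_j` on the ball then converge to `λ₀`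
(`tendsto_argmax_of_tendsto_coeff`), and they can be chosen measurably
(`exists_measurable_argmax`).
-/

noncomputable section

namespace DiffQML

/-! ### A strong law for non-identically distributed variables -/

section StrongLaw

/-- **Kronecker's lemma** with weights `1 / (n + 1)`. -/
theorem tendsto_average_of_tendsto_sum_div {u : ℕ → ℝ} {c : ℝ}
    (h : Tendsto (fun n => ∑ i ∈ Finset.range n, u i / (i + 1)) atTop (𝓝 c)) :
    Tendsto (fun N : ℕ => (N : ℝ)⁻¹ * ∑ i ∈ Finset.range N, u i) atTop (𝓝 0) := by
  set s : ℕ → ℝ := fun n => ∑ i ∈ Finset.range n, u i / (i + 1) with hs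
  -- summation by parts
  have key : ∀ N : ℕ, ∑ i ∈ Finset.range N, u i = N * s N - ∑ i ∈ Finset.range N, s i := by
    intro N
    induction N with
    | zero => simp
    | succ N ih =>
      have h1 : s (N + 1) = s N + u N / (N + 1) := Finset.sum_range_succ _ _
      rw [Finset.sum_range_succ, Finset.sum_range_succ, ih, h1]
      have : (N : ℝ) + 1 ≠ 0 := by positivity
      push_cast
      field_simp
      ring
  have h2 := h.sub h.cesaro
  rw [sub_self] at h2
  refine h2.congr' ?_
  filter_upwards [eventually_gt_atTop 0] with N hN
  have : (N : ℝ) ≠ 0 := by positivity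
  rw [key, mul_sub, inv_mul_cancel_left₀ this]

theorem tendsto_average {u : ℕ → ℝ} {c : ℝ} (h : Tendsto u atTop (𝓝 c)) :
    Tendsto (fun N : ℕ => (N : ℝ)⁻¹ * ∑ i ∈ Finset.range N, u i) atTop (𝓝 c) := h.cesaro

theorem sq_truncation_le {Ω : Type*} {f : Ω → ℝ} {A r : ℝ} (hA : 0 < A) (hr : 0 < r) (hr2 : r ≤ 2)
    (ω : Ω) :
    truncation f A ω ^ 2 ≤ A ^ (2 - r) * |f ω| ^ r := by
  have h1 : |truncation f A ω| ≤ A := (abs_truncation_le_bound f A ω).trans (abs_of_pos hA).le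
  have h2 := abs_truncation_le_abs_self f A ω
  set t := |truncation f A ω| with ht
  have h0 : 0 ≤ t := abs_nonneg _
  rcases h0.eq_or_lt with h | h
  · rw [← sq_abs, ← ht, ← h, zero_pow two_ne_zero]; positivity
  · calc truncation f A ω ^ 2 = t ^ (2 - r) * t ^ r := by
          rw [← Real.rpow_add h, sub_add_cancel, ← sq_abs, ← ht]; norm_cast
      _ ≤ A ^ (2 - r) * |f ω| ^ r := by
          gcongr

theorem abs_sub_truncation_le {Ω : Type*} {f : Ω → ℝ} {A r : ℝ} (hA : 0 < A) (hr : 1 ≤ r) (ω : Ω) :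
    |f ω - truncation f A ω| ≤ A ^ (1 - r) * |f ω| ^ r := by
  by_cases h : |f ω| < A
  · rw [truncation_eq_self h, sub_self, abs_zero]; positivity
  · push Not at h
    have h1 : |f ω - truncation f A ω| ≤ |f ω| := by
      unfold truncation
      simp only [Function.comp, Set.indicator, id]
      split_ifs <;> simp
    have hpos : 0 < |f ω| := hA.trans_le h
    calc |f ω - truncation f A ω| ≤ |f ω| := h1
      _ = |f ω| ^ (1 - r) * |f ω| ^ r := by
          rw [← Real.rpow_add hpos]; simp
      _ ≤ A ^ (1 - r) * |f ω| ^ r := by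
          refine mul_le_mul_of_nonneg_right ?_ (by positivity)
          exact Real.rpow_le_rpow_of_nonpos hA h (by linarith)

variable {Ω : Type*} [MeasurableSpace Ω] {P : Measure Ω} [IsProbabilityMeasure P]

/-- **Kolmogorov's convergence theorem**: a series of independent centered random variables
converges almost surely if the variances are summable. -/
theorem ae_exists_tendsto_sum_of_summable_sq {X : ℕ → Ω → ℝ} (hm : ∀ n, Measurable (X n))
    (hindep : iIndepFun X P) (hL2 : ∀ n, MemLp (X n) 2 P) (hzero : ∀ n, ∫ ω, X n ω ∂P = 0)
    (hsum : Summable fun n => ∫ ω, X n ω ^ 2 ∂P) :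
    ∀ᵐ ω ∂P, ∃ c, Tendsto (fun n => ∑ i ∈ Finset.range n, X i ω) atTop (𝓝 c) := by
  have hint : ∀ n, Integrable (X n) P := fun n => (hL2 n).integrable (by norm_num)
  set ℱ := Filtration.natural X (fun n => (hm n).stronglyMeasurable)
  set f : ℕ → Ω → ℝ := fun n => ∑ i ∈ Finset.range (n + 1), X i with hf
  have hadX : ∀ i, StronglyMeasurable[ℱ i] (X i) := Filtration.stronglyAdapted_natural _
  have hmart : Martingale f ℱ P := by
    refine martingale_nat ?_ (fun n => integrable_finsetSum' _ fun i _ => hint i) ?_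
    · intro n
      refine Finset.stronglyMeasurable_sum _ fun i hi => ?_
      exact (hadX i).mono (ℱ.mono (by simpa [Nat.lt_succ_iff] using hi))
    · intro n
      have h1 : f (n + 1) = f n + X (n + 1) := Finset.sum_range_succ _ _
      have hfn : StronglyMeasurable[ℱ n] (f n) :=
        Finset.stronglyMeasurable_sum _ fun i hi =>
          (hadX i).mono (ℱ.mono (by simpa [Nat.lt_succ_iff] using hi))
      have hfi : Integrable (f n) P := integrable_finsetSum' _ fun i _ => hint i
      have h2 := condExp_add hfi (hint (n + 1)) (ℱ n)
      rw [h1]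
      have h3 : P[X (n + 1) | ℱ n] =ᵐ[P] fun _ => P[X (n + 1)] :=
        iIndepFun.condExp_natural_ae_eq_of_lt (fun n => (hm n).stronglyMeasurable) hindep
          n.lt_succ_self
      have h4 := condExp_of_stronglyMeasurable (ℱ.le n) hfn hfi
      filter_upwards [h2, h3] with ω h2 h3
      rw [h2, Pi.add_apply, h4, h3, hzero, add_zero]
  set R : ℝ := ∑' n, ∫ ω, X n ω ^ 2 ∂P
  have hfL2 : ∀ n, MemLp (f n) 2 P := fun n => memLp_finsetSum' _ fun i _ => hL2 i
  have hfsq : ∀ n, ∫ ω, f n ω ^ 2 ∂P ≤ R := by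
    intro n
    have h0 : ∫ ω, f n ω ∂P = 0 := by
      simp only [hf, Finset.sum_apply]
      rw [integral_finsetSum _ fun i _ => hint i]
      exact Finset.sum_eq_zero fun i _ => hzero i
    have h1 : Var[f n; P] = ∑ i ∈ Finset.range (n + 1), Var[X i; P] :=
      IndepFun.variance_sum (fun i _ => hL2 i) fun i _ j _ hij => hindep.indepFun hij
    rw [variance_of_integral_eq_zero (hfL2 n).aemeasurable h0] at h1
    calc ∫ ω, f n ω ^ 2 ∂P = ∑ i ∈ Finset.range (n + 1), ∫ ω, X i ω ^ 2 ∂P := by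
          rw [h1]
          exact Finset.sum_congr rfl fun i _ =>
            variance_of_integral_eq_zero (hm i).aemeasurable (hzero i)
      _ ≤ R := hsum.sum_le_tsum _ fun i _ => integral_nonneg fun ω => sq_nonneg _
  have hbdd : ∀ n, eLpNorm (f n) 1 P ≤ ((1 + R).toNNReal : ENNReal) := by
    intro n
    rw [eLpNorm_one_eq_lintegral_enorm,
      ← ofReal_integral_norm_eq_lintegral_enorm ((hfL2 n).integrable (by norm_num)),
      ENNReal.ofReal]
    refine ENNReal.coe_le_coe.2 (Real.toNNReal_le_toNNReal ?_)
    calc ∫ ω, ‖f n ω‖ ∂P ≤ ∫ ω, (1 + f n ω ^ 2) ∂P := by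
          refine integral_mono ((hfL2 n).integrable (by norm_num)).norm
            ((integrable_const _).add (hfL2 n).integrable_sq) fun ω => ?_
          simp only [Real.norm_eq_abs]
          nlinarith [sq_abs (f n ω), sq_nonneg (|f n ω| - 1)]
      _ = 1 + ∫ ω, f n ω ^ 2 ∂P := by
          rw [integral_add (integrable_const _) (hfL2 n).integrable_sq]; simp
      _ ≤ 1 + R := by linarith [hfsq n]
  filter_upwards [hmart.submartingale.exists_ae_tendsto_of_bdd hbdd] with ω ⟨c, hc⟩
  refine ⟨c, (tendsto_add_atTop_iff_nat 1).1 ?_⟩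
  simpa [hf] using hc

theorem summable_add_one_rpow_neg {r : ℝ} (hr : 1 < r) :
    Summable fun n : ℕ => ((n : ℝ) + 1) ^ (-r) := by
  have := (summable_nat_add_iff 1).2 (Real.summable_nat_rpow.2 (by linarith : -r < -1))
  simpa using this

/-- The strong law for moments of order `1 < r ≤ 2`: the variable with index `n` is truncated at
`n + 1`, and the series of the centered truncations divided by `n + 1` converges by Kolmogorov's
theorem. -/
theorem strong_law_of_moment_le_two {X : ℕ → Ω → ℝ} (hm : ∀ n, Measurable (X n))
    (hindep : iIndepFun X P) {r M : ℝ} (hr : 1 < r) (hr2 : r ≤ 2)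
    (hint : ∀ n, Integrable (X n) P)
    (hintr : ∀ n, Integrable (fun ω => |X n ω| ^ r) P) (hM : ∀ n, ∫ ω, |X n ω| ^ r ∂P ≤ M) :
    ∀ᵐ ω ∂P, Tendsto
      (fun N : ℕ => (N : ℝ)⁻¹ * ∑ i ∈ Finset.range N, (X i ω - ∫ ω', X i ω' ∂P)) atTop (𝓝 0) := by
  have hA : ∀ n : ℕ, (0 : ℝ) < n + 1 := fun n => by positivity
  set Y : ℕ → Ω → ℝ := fun n => truncation (X n) (n + 1) with hY
  have hmI : ∀ n : ℕ, Measurable ((Set.Ioc (-((n : ℝ) + 1)) (n + 1)).indicator (id : ℝ → ℝ)) :=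
    fun n => measurable_id.indicator measurableSet_Ioc
  have hYm : ∀ n, Measurable (Y n) := fun n => (hmI n).comp (hm n)
  have hYL2 : ∀ n, MemLp (Y n) 2 P := fun n => (hm n).aestronglyMeasurable.memLp_truncation
  have hYint : ∀ n, Integrable (Y n) P := fun n => (hYL2 n).integrable (by norm_num)
  -- truncation changes almost surely only finitely many terms
  have hev : ∀ᵐ ω ∂P, ∀ᶠ n in atTop, X n ω = Y n ω := by
    -- Markov's inequality for the moment of order `r`
    have hmeas : ∀ n : ℕ, P {ω | (n : ℝ) + 1 ≤ |X n ω|} ≤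
        ENNReal.ofReal (M * ((n : ℝ) + 1) ^ (-r)) := by
      intro n
      have h1 := mul_meas_ge_le_integral_of_nonneg
        (Eventually.of_forall fun ω => by positivity) (hintr n) (((n : ℝ) + 1) ^ r)
      have hset : {ω | (n : ℝ) + 1 ≤ |X n ω|} = {ω | ((n : ℝ) + 1) ^ r ≤ |X n ω| ^ r} := by
        ext ω
        exact (Real.rpow_le_rpow_iff (hA n).le (abs_nonneg _) (by linarith)).symm
      rw [hset, ← ofReal_measureReal]
      refine ENNReal.ofReal_le_ofReal ?_
      rw [Real.rpow_neg (hA n).le, ← div_eq_mul_inv, le_div_iff₀ (by have := hA n; positivity),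
        mul_comm]
      exact h1.trans (hM n)
    have hfin : ∑' n : ℕ, P {ω | (n : ℝ) + 1 ≤ |X n ω|} ≠ ⊤ := by
      refine ne_top_of_le_ne_top ?_ (ENNReal.tsum_le_tsum hmeas)
      exact ((summable_add_one_rpow_neg hr).mul_left M).tsum_ofReal_ne_top
    filter_upwards [ae_eventually_notMem hfin] with ω hω
    filter_upwards [hω] with n hn
    simp only [not_le] at hn
    exact (truncation_eq_self hn).symm
  -- the normalized centered truncations form an almost surely convergent series
  set Z : ℕ → Ω → ℝ := fun n ω => (Y n ω - ∫ ω', Y n ω' ∂P) / (n + 1) with hZ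
  have hser : ∀ᵐ ω ∂P, ∃ c, Tendsto (fun n => ∑ i ∈ Finset.range n, Z i ω) atTop (𝓝 c) := by
    refine ae_exists_tendsto_sum_of_summable_sq
      (fun n => ((hYm n).sub_const _).div_const _) ?_ ?_ ?_ ?_
    · exact hindep.comp
        (fun n x => ((Set.Ioc (-((n : ℝ) + 1)) (n + 1)).indicator id x - ∫ ω', Y n ω' ∂P) / (n + 1))
        fun n => ((hmI n).sub_const _).div_const _
    · intro n
      have := ((hYL2 n).sub (memLp_const (∫ ω', Y n ω' ∂P))).mul_const ((n : ℝ) + 1)⁻¹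
      simpa [hZ, div_eq_mul_inv] using this
    · intro n
      simp only [hZ]
      rw [integral_div, integral_sub (hYint n) (integrable_const _)]
      simp
    · refine Summable.of_nonneg_of_le (fun n => integral_nonneg fun ω => sq_nonneg _) (fun n => ?_)
        ((summable_add_one_rpow_neg hr).mul_left M)
      have h1 : ∫ ω, Z n ω ^ 2 ∂P = Var[Y n; P] / ((n : ℝ) + 1) ^ 2 := by
        rw [variance_eq_integral (hYm n).aemeasurable]
        simp only [hZ, div_pow]
        rw [integral_div]
      have h2 : Var[Y n; P] ≤ ((n : ℝ) + 1) ^ (2 - r) * M := by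
        calc Var[Y n; P] ≤ ∫ ω, Y n ω ^ 2 ∂P :=
              variance_le_expectation_sq (hYm n).aestronglyMeasurable
          _ ≤ ∫ ω, ((n : ℝ) + 1) ^ (2 - r) * |X n ω| ^ r ∂P :=
              integral_mono (hYL2 n).integrable_sq ((hintr n).const_mul _)
                fun ω => sq_truncation_le (hA n) (by linarith) hr2 ω
          _ ≤ _ := by
              rw [integral_const_mul]
              exact mul_le_mul_of_nonneg_left (hM n) (Real.rpow_nonneg (hA n).le _)
      rw [h1, div_le_iff₀ (by have := hA n; positivity)]
      refine h2.trans (le_of_eq ?_)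
      rw [mul_comm, mul_assoc, ← Real.rpow_natCast _ 2, ← Real.rpow_add (hA n)]
      congr 2
      push_cast
      ring
  -- the truncation changes the means by a null sequence
  have hmean : Tendsto (fun n => (∫ ω, Y n ω ∂P) - ∫ ω, X n ω ∂P) atTop (𝓝 0) := by
    have hlim : Tendsto (fun n : ℕ => ((n : ℝ) + 1) ^ (1 - r) * M) atTop (𝓝 0) := by
      have h1 : Tendsto (fun n : ℕ => (n : ℝ) + 1) atTop atTop :=
        tendsto_atTop_add_const_right _ _ tendsto_natCast_atTop_atTop
      have h2 := (tendsto_rpow_neg_atTop (by linarith : 0 < r - 1)).comp h1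
      have h3 := h2.mul_const M
      rw [zero_mul] at h3
      refine h3.congr fun n => ?_
      simp only [Function.comp, neg_sub]
    refine squeeze_zero_norm (fun n => ?_) hlim
    rw [← integral_sub (hYint n) (hint n)]
    calc ‖∫ ω, (Y n ω - X n ω) ∂P‖ ≤ ∫ ω, ((n : ℝ) + 1) ^ (1 - r) * |X n ω| ^ r ∂P := by
          refine norm_integral_le_of_norm_le ((hintr n).const_mul _) (Eventually.of_forall ?_)
          intro ω
          rw [Real.norm_eq_abs, abs_sub_comm]
          exact abs_sub_truncation_le (hA n) hr.le ω
      _ ≤ _ := by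
          rw [integral_const_mul]
          exact mul_le_mul_of_nonneg_left (hM n) (Real.rpow_nonneg (hA n).le _)
  filter_upwards [hev, hser] with ω h1 ⟨c, h2⟩
  have h3 := tendsto_average_of_tendsto_sum_div h2
  have h4 : Tendsto (fun n => X n ω - Y n ω) atTop (𝓝 0) :=
    tendsto_const_nhds.congr' (by filter_upwards [h1] with n hn; simp [hn])
  have h5 := h3.add (tendsto_average (h4.add hmean))
  simp only [add_zero] at h5
  refine h5.congr fun N => ?_
  rw [← mul_add, ← Finset.sum_add_distrib]
  congr 1
  exact Finset.sum_congr rfl fun i _ => by ring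

/-- **Strong law of large numbers** for independent, not necessarily identically distributed
random variables with uniformly bounded absolute moments of some order `r > 1`. -/
theorem strong_law_of_moment {X : ℕ → Ω → ℝ} (hm : ∀ n, Measurable (X n))
    (hindep : iIndepFun X P) {r M : ℝ} (hr : 1 < r)
    (hintr : ∀ n, Integrable (fun ω => |X n ω| ^ r) P) (hM : ∀ n, ∫ ω, |X n ω| ^ r ∂P ≤ M) :
    ∀ᵐ ω ∂P, Tendsto
      (fun N : ℕ => (N : ℝ)⁻¹ * ∑ i ∈ Finset.range N, (X i ω - ∫ ω', X i ω' ∂P)) atTop (𝓝 0) := by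
  have hle : ∀ {s : ℝ}, 0 ≤ s → s ≤ r → ∀ n ω, |X n ω| ^ s ≤ 1 + |X n ω| ^ r := by
    intro s hs0 hs n ω
    rcases le_total |X n ω| 1 with h | h
    · have := Real.rpow_le_one (abs_nonneg (X n ω)) h hs0
      have : 0 ≤ |X n ω| ^ r := by positivity
      linarith
    · have := Real.rpow_le_rpow_of_exponent_le h hs
      linarith
  have hi : ∀ {s : ℝ}, 0 ≤ s → s ≤ r → ∀ n, Integrable (fun ω => |X n ω| ^ s) P := by
    intro s hs0 hs n
    refine ((integrable_const (1 : ℝ)).add (hintr n)).mono'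
      ((hm n).abs.pow_const s).aestronglyMeasurable (Eventually.of_forall fun ω => ?_)
    rw [Real.norm_of_nonneg (by positivity)]
    exact hle hs0 hs n ω
  have h0 : 0 ≤ min r 2 := le_min (by linarith) (by norm_num)
  refine strong_law_of_moment_le_two hm hindep (r := min r 2) (M := 1 + M)
    (lt_min hr (by norm_num)) (min_le_right _ _) (fun n => ?_) (hi h0 (min_le_left _ _)) fun n => ?_
  · have := hi zero_le_one hr.le n
    simp only [Real.rpow_one] at this
    exact (integrable_norm_iff (hm n).aestronglyMeasurable).1 this
  · calc _ ≤ ∫ ω, (1 + |X n ω| ^ r) ∂P :=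
          integral_mono (hi h0 (min_le_left _ _) n) ((integrable_const _).add (hintr n))
            (hle h0 (min_le_left _ _) n)
      _ ≤ 1 + M := by
          rw [integral_add (integrable_const _) (hintr n)]
          simpa using hM n

end StrongLaw

/-! ### Measurable selection of maximizers -/

section Selection

variable {Ω E ι : Type*} [MeasurableSpace Ω]

/-- A set-valued map whose hitting sets of closed sets are measurable. -/
def HitMeasurable [TopologicalSpace E] (A : Ω → Set E) : Prop :=
  ∀ K, IsClosed K → MeasurableSet {ω | (A ω ∩ K).Nonempty}

/-- Restricting to the minimizers of a continuous function preserves measurability. -/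
theorem HitMeasurable.argmin [TopologicalSpace E] [T2Space E] {A : Ω → Set E}
    (hA : HitMeasurable A) (hc : ∀ ω, IsCompact (A ω)) {g : E → ℝ} (hg : Continuous g) :
    HitMeasurable fun ω => {x ∈ A ω | ∀ y ∈ A ω, g x ≤ g y} := by
  intro K hK
  -- the minimum over `A ω` is attained in `K` iff no rational number separates the two minima
  have key : {ω | ({x ∈ A ω | ∀ y ∈ A ω, g x ≤ g y} ∩ K).Nonempty} =
      {ω | (A ω ∩ K).Nonempty} ∩ ⋂ c : ℚ, ({ω | (A ω ∩ {x | g x ≤ c}).Nonempty}ᶜ ∪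
        {ω | (A ω ∩ (K ∩ {x | g x ≤ c})).Nonempty}) := by
    ext ω
    simp only [Set.mem_inter_iff, Set.mem_iInter, Set.mem_union, Set.mem_compl_iff]
    constructor
    · rintro ⟨x, ⟨hxA, hx⟩, hxK⟩
      refine ⟨⟨x, hxA, hxK⟩, fun c => or_iff_not_imp_left.2 fun h => ?_⟩
      obtain ⟨y, hyA, hy⟩ := not_not.1 h
      exact ⟨x, hxA, hxK, (hx y hyA).trans hy⟩
    · rintro ⟨hne, h⟩
      obtain ⟨x, ⟨hxA, hxK⟩, hx⟩ :=
        ((hc ω).inter_right hK).exists_isMinOn hne hg.continuousOn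
      refine ⟨x, ⟨hxA, fun y hy => ?_⟩, hxK⟩
      by_contra hlt
      obtain ⟨c, hc1, hc2⟩ := exists_rat_btwn (not_le.1 hlt)
      rcases h c with h | ⟨z, hzA, hzK, hz⟩
      · exact h ⟨y, hy, hc1.le⟩
      · exact absurd (hx ⟨hzA, hzK⟩) (not_le.2 (lt_of_le_of_lt hz hc2))
  rw [key]
  have hcl : ∀ c : ℚ, IsClosed {x | g x ≤ c} := fun c => isClosed_le hg continuous_const
  exact (hA K hK).inter (MeasurableSet.iInter fun c =>
    (hA _ (hcl c)).compl.union (hA _ (hK.inter (hcl c))))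

/-- A compact-valued measurable set-valued map has a measurable selection: minimizing finitely many
functions that separate points, one after the other, leaves a single point. -/
theorem HitMeasurable.exists_measurable_selection [TopologicalSpace E] [T2Space E]
    [MeasurableSpace E] [BorelSpace E] [Finite ι] {g : ι → E → ℝ} (hg : ∀ i, Continuous (g i))
    (hsep : ∀ x y, (∀ i, g i x = g i y) → x = y) {A : Ω → Set E} (hA : HitMeasurable A)
    (hc : ∀ ω, IsCompact (A ω)) (hne : ∀ ω, (A ω).Nonempty) :
    ∃ s : Ω → E, Measurable s ∧ ∀ ω, s ω ∈ A ω := by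
  classical
  have := Fintype.ofFinite ι
  have key : ∀ t : Finset ι, ∃ B : Ω → Set E, HitMeasurable B ∧ (∀ ω, IsCompact (B ω)) ∧
      (∀ ω, (B ω).Nonempty) ∧ (∀ ω, B ω ⊆ A ω) ∧
      ∀ ω, ∀ x ∈ B ω, ∀ y ∈ B ω, ∀ i ∈ t, g i x = g i y := by
    intro t
    induction t using Finset.induction_on with
    | empty => exact ⟨A, hA, hc, hne, fun ω => subset_rfl, by simp⟩
    | insert i t _ ih =>
      obtain ⟨B, h1, h2, h3, h4, h5⟩ := ih
      refine ⟨fun ω => {x ∈ B ω | ∀ y ∈ B ω, g i x ≤ g i y}, h1.argmin h2 (hg i), fun ω => ?_,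
        fun ω => ?_, fun ω => (Set.sep_subset _ _).trans (h4 ω), fun ω x hx y hy j hj => ?_⟩
      · have : {x ∈ B ω | ∀ y ∈ B ω, g i x ≤ g i y} = B ω ∩ ⋂ y ∈ B ω, {x | g i x ≤ g i y} := by
          ext x; simp
        change IsCompact {x | x ∈ B ω ∧ ∀ y ∈ B ω, g i x ≤ g i y}
        rw [this]
        exact (h2 ω).inter_right (isClosed_biInter fun y _ => isClosed_le (hg i) continuous_const)
      · obtain ⟨x, hx, hx'⟩ := (h2 ω).exists_isMinOn (h3 ω) (hg i).continuousOn
        exact ⟨x, hx, hx'⟩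
      · rcases Finset.mem_insert.1 hj with rfl | hj
        · exact le_antisymm (hx.2 y hy.1) (hy.2 x hx.1)
        · exact h5 ω x hx.1 y hy.1 j hj
  obtain ⟨B, h1, -, h3, h4, h5⟩ := key Finset.univ
  choose s hs using h3
  refine ⟨s, measurable_of_isClosed fun K hK => ?_, fun ω => h4 ω (hs ω)⟩
  have : s ⁻¹' K = {ω | (B ω ∩ K).Nonempty} := by
    ext ω
    refine ⟨fun h => ⟨s ω, hs ω, h⟩, ?_⟩
    rintro ⟨x, hx, hxK⟩
    have : s ω = x := hsep _ _ fun i => h5 ω _ (hs ω) _ hx i (Finset.mem_univ i)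
    rwa [Set.mem_preimage, this]
  rw [this]
  exact h1 K hK

/-- A random continuous function on a compact set has a measurable maximizer. -/
theorem exists_measurable_argmax [MetricSpace E] [SecondCountableTopology E]
    [MeasurableSpace E] [BorelSpace E] [Finite ι] {g : ι → E → ℝ} (hg : ∀ i, Continuous (g i))
    (hsep : ∀ x y, (∀ i, g i x = g i y) → x = y) {C : Set E} (hC : IsCompact C)
    (hne : C.Nonempty) {f : Ω → E → ℝ} (hf : ∀ ω, ContinuousOn (f ω) C)
    (hm : ∀ x ∈ C, Measurable fun ω => f ω x) :
    ∃ s : Ω → E, Measurable s ∧ ∀ ω, s ω ∈ C ∧ IsMaxOn (f ω) C (s ω) := by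
  -- suprema over subsets of `C` are suprema over countable dense subsets
  have hdense : ∀ S ⊆ C, ∀ c : ℝ, MeasurableSet {ω | ∃ x ∈ S, c < f ω x} := by
    intro S hS c
    obtain ⟨D, hDS, hDc, hSD⟩ :=
      (TopologicalSpace.IsSeparable.of_separableSpace S).exists_countable_dense_subset
    have : {ω | ∃ x ∈ S, c < f ω x} = ⋃ x ∈ D, {ω | c < f ω x} := by
      ext ω
      simp only [Set.mem_iUnion, exists_prop]
      constructor
      · rintro ⟨x, hx, hlt⟩
        have h1 : ∀ᶠ y in 𝓝[S] x, c < f ω y := ((hf ω).mono hS x hx).eventually (lt_mem_nhds hlt)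
        have h2 : ∃ᶠ y in 𝓝[S] x, y ∈ D := by
          have : (𝓝[D] x).NeBot := mem_closure_iff_nhdsWithin_neBot.1 (hSD hx)
          exact (Eventually.frequently (f := 𝓝[D] x) self_mem_nhdsWithin).filter_mono
            (nhdsWithin_mono x hDS)
        obtain ⟨y, hy, hyD⟩ := (h1.and_frequently h2).exists
        exact ⟨y, hyD, hy⟩
      · rintro ⟨x, hx, hlt⟩
        exact ⟨x, hDS hx, hlt⟩
    rw [this]
    exact MeasurableSet.biUnion hDc fun x hx =>
      measurableSet_lt measurable_const (hm x (hS (hDS hx)))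
  have hcomp : ∀ ω, IsCompact {x ∈ C | IsMaxOn (f ω) C x} := by
    intro ω
    obtain ⟨x, hx, hx'⟩ := hC.exists_isMaxOn hne (hf ω)
    have : {x ∈ C | IsMaxOn (f ω) C x} = C ∩ f ω ⁻¹' Set.Ici (f ω x) := by
      ext y
      exact ⟨fun h => ⟨h.1, h.2 hx⟩, fun h => ⟨h.1, isMaxOn_iff.2 fun z hz => (hx' hz).trans h.2⟩⟩
    rw [this]
    exact hC.of_isClosed_subset ((hf ω).preimage_isClosed_of_isClosed hC.isClosed isClosed_Ici)
      Set.inter_subset_left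
  have hhit : HitMeasurable fun ω => {x ∈ C | IsMaxOn (f ω) C x} := by
    intro K hK
    rcases (C ∩ K).eq_empty_or_nonempty with hCK | hCK
    · have : {ω | ({x ∈ C | IsMaxOn (f ω) C x} ∩ K).Nonempty} = ∅ := by
        refine Set.eq_empty_of_forall_notMem fun ω => ?_
        rintro ⟨x, hx, hxK⟩
        exact (hCK ▸ (⟨hx.1, hxK⟩ : x ∈ C ∩ K) : x ∈ (∅ : Set E))
      rw [this]
      exact MeasurableSet.empty
    -- a maximizer lies in `K` iff no rational number separates the suprema over `C` and `C ∩ K`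
    have key : {ω | ({x ∈ C | IsMaxOn (f ω) C x} ∩ K).Nonempty} =
        ⋂ c : ℚ, ({ω | ∃ x ∈ C, (c : ℝ) < f ω x}ᶜ ∪ {ω | ∃ x ∈ C ∩ K, (c : ℝ) < f ω x}) := by
      ext ω
      simp only [Set.mem_iInter, Set.mem_union, Set.mem_compl_iff]
      constructor
      · rintro ⟨x, ⟨hxC, hx⟩, hxK⟩ c
        refine or_iff_not_imp_left.2 fun h => ?_
        obtain ⟨y, hyC, hy⟩ := not_not.1 h
        exact ⟨x, ⟨hxC, hxK⟩, hy.trans_le (hx hyC)⟩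
      · intro h
        obtain ⟨x, hx, hx'⟩ := (hC.inter_right hK).exists_isMaxOn hCK
          ((hf ω).mono Set.inter_subset_left)
        refine ⟨x, ⟨hx.1, isMaxOn_iff.2 fun y hy => ?_⟩, hx.2⟩
        by_contra hlt
        obtain ⟨c, hc1, hc2⟩ := exists_rat_btwn (not_le.1 hlt)
        rcases h c with h | ⟨z, hz, hzc⟩
        · exact h ⟨y, hy, hc2⟩
        · exact absurd (hx' hz) (not_le.2 (hc1.trans hzc))
    rw [key]
    exact MeasurableSet.iInter fun c =>
      (hdense C subset_rfl c).compl.union (hdense _ Set.inter_subset_left c)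
  obtain ⟨s, hs, hs'⟩ := hhit.exists_measurable_selection hg hsep hcomp fun ω => by
    obtain ⟨x, hx, hx'⟩ := hC.exists_isMaxOn hne (hf ω)
    exact ⟨x, hx, hx'⟩
  exact ⟨s, hs, hs'⟩

end Selection

/-! ### Strict local maxima and convergence of maximizers -/

/-- A negative definite bilinear form on a finite-dimensional space is uniformly negative. -/
theorem exists_pos_le_neg_mul_sq {E : Type*} [NormedAddCommGroup E] [NormedSpace ℝ E]
    [FiniteDimensional ℝ E] (B : E →L[ℝ] E →L[ℝ] ℝ) (hB : ∀ v, v ≠ 0 → B v v < 0) :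
    ∃ c > 0, ∀ v, B v v ≤ -c * ‖v‖ ^ 2 := by
  rcases (Metric.sphere (0 : E) 1).eq_empty_or_nonempty with h | h
  · refine ⟨1, one_pos, fun v => ?_⟩
    have : v = 0 := by
      by_contra hv
      have : ‖v‖⁻¹ • v ∈ Metric.sphere (0 : E) 1 := by simp [norm_smul, hv]
      rw [h] at this
      exact this
    simp [this]
  · have hcont : Continuous fun v => B v v := by fun_prop
    obtain ⟨w, hw, hmax⟩ := (isCompact_sphere (0 : E) 1).exists_isMaxOn h hcont.continuousOn
    have hw0 : w ≠ 0 := by rintro rfl; simp at hw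
    refine ⟨-B w w, by linarith [hB w hw0], fun v => ?_⟩
    rcases eq_or_ne v 0 with rfl | hv
    · simp
    · have hn : ‖v‖ ≠ 0 := norm_ne_zero_iff.2 hv
      have h1 : B (‖v‖⁻¹ • v) (‖v‖⁻¹ • v) ≤ B w w := hmax (by simp [norm_smul, hv])
      simp only [map_smul, _root_.smul_apply, smul_eq_mul] at h1
      have h2 : B v v = ‖v‖ ^ 2 * (‖v‖⁻¹ * (‖v‖⁻¹ * B v v)) := by field_simp
      rw [h2, neg_neg, mul_comm]
      exact mul_le_mul_of_nonneg_right h1 (by positivity)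

/-- **Second-order sufficient condition** for a strict local maximum. -/
theorem exists_lt_on_closedBall {E : Type*} [NormedAddCommGroup E] [NormedSpace ℝ E]
    [FiniteDimensional ℝ E] {f : E → ℝ} {x₀ : E} (hf : ContDiffAt ℝ 2 f x₀)
    (h0 : fderiv ℝ f x₀ = 0) (hneg : ∀ v, v ≠ 0 → fderiv ℝ (fderiv ℝ f) x₀ v v < 0) :
    ∃ r > 0, ∀ x ∈ Metric.closedBall x₀ r, x ≠ x₀ → f x < f x₀ := by
  obtain ⟨c, hc, hB⟩ := exists_pos_le_neg_mul_sq _ hneg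
  have hd : ∀ᶠ x in 𝓝 x₀, DifferentiableAt ℝ f x := by
    filter_upwards [hf.eventually (by simp)] with x hx using hx.differentiableAt (by norm_num)
  -- near `x₀` the first derivative differs from `B (x - x₀)` by at most `c / 2 * ‖x - x₀‖`, so the
  -- derivative along the segment from `x₀` to `x` is negative in its interior
  have hD : HasFDerivAt (fderiv ℝ f) (fderiv ℝ (fderiv ℝ f) x₀) x₀ :=
    ((hf.fderiv_right (m := 1) (by norm_num)).differentiableAt (by norm_num)).hasFDerivAt
  have ho := hD.isLittleO.def (half_pos hc)
  obtain ⟨r, hr, hball⟩ := Metric.nhds_basis_closedBall.eventually_iff.1 (hd.and ho)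
  refine ⟨r, hr, fun x hx hne => ?_⟩
  set v := x - x₀ with hv
  have hv0 : v ≠ 0 := sub_ne_zero.2 hne
  have hmem : ∀ t ∈ Set.Icc (0 : ℝ) 1, x₀ + t • v ∈ Metric.closedBall x₀ r := by
    intro t ht
    rw [Metric.mem_closedBall, dist_eq_norm] at hx ⊢
    rw [add_sub_cancel_left, norm_smul, Real.norm_of_nonneg ht.1]
    exact (mul_le_of_le_one_left (norm_nonneg _) ht.2).trans hx
  have hder : ∀ t ∈ Set.Icc (0 : ℝ) 1,
      HasDerivAt (fun t : ℝ => f (x₀ + t • v)) (fderiv ℝ f (x₀ + t • v) v) t := by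
    intro t ht
    have h1 : HasDerivAt (fun t : ℝ => x₀ + t • v) v t := by
      simpa using ((hasDerivAt_id t).smul_const v).const_add x₀
    exact (hball (hmem t ht)).1.hasFDerivAt.comp_hasDerivAt t h1
  obtain ⟨t, ht, hmvt⟩ := exists_hasDerivAt_eq_slope (fun t : ℝ => f (x₀ + t • v)) _ one_pos
    (fun t ht => (hder t ht).continuousAt.continuousWithinAt)
    (fun t ht => hder t (Set.Ioo_subset_Icc_self ht))
  have hb := (hball (hmem t (Set.Ioo_subset_Icc_self ht))).2
  rw [h0, sub_zero, add_sub_cancel_left] at hb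
  set A := fderiv ℝ f (x₀ + t • v) with hA
  set B := fderiv ℝ (fderiv ℝ f) x₀
  have h1 : A v - t * B v v ≤ c / 2 * (t * ‖v‖) * ‖v‖ := by
    have h2 := (A - B (t • v)).le_of_opNorm_le hb v
    have h3 := (le_abs_self _).trans ((Real.norm_eq_abs _).symm.le.trans h2)
    simpa [norm_smul, abs_of_pos ht.1] using h3
  have h2 := mul_le_mul_of_nonneg_left (hB v) ht.1.le
  have h3 : 0 < c * t * ‖v‖ ^ 2 := by
    have := ht.1
    have := norm_pos_iff.2 hv0
    positivity
  have h4 : A v = f x - f x₀ := by rw [hmvt]; simp [hv]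
  nlinarith

/-- Maximizers over a compact set of linear combinations of fixed continuous functions converge to
the unique maximizer of the limiting combination. -/
theorem tendsto_argmax_of_tendsto_coeff {E J : Type*} [TopologicalSpace E] [Fintype J]
    {C : Set E} (hC : IsCompact C) {φ : J → E → ℝ} (hφ : ∀ j, ContinuousOn (φ j) C)
    {z : ℕ → J → ℝ} {m : J → ℝ} (hz : ∀ j, Tendsto (fun n => z n j) atTop (𝓝 (m j))) {x₀ : E}
    (huniq : ∀ x ∈ C, x ≠ x₀ → ∑ j, m j * φ j x < ∑ j, m j * φ j x₀)
    {s : ℕ → E} (hs : ∀ n, s n ∈ C)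
    (hmax : ∀ n, ∑ j, z n j * φ j x₀ ≤ ∑ j, z n j * φ j (s n)) :
    Tendsto s atTop (𝓝 x₀) := by
  refine hC.tendsto_nhds_of_unique_mapClusterPt (Eventually.of_forall hs) fun x hx hcl => ?_
  by_contra hne
  -- the maximum inequality passes to the limit along an ultrafilter converging to `x`
  obtain ⟨U, hU, hUx⟩ := mapClusterPt_iff_ultrafilter.1 hcl
  have h1 : Tendsto s U (𝓝[C] x) := tendsto_nhdsWithin_iff.2 ⟨hUx, Eventually.of_forall hs⟩
  have h2 : Tendsto (fun n => ∑ j, z n j * φ j (s n)) U (𝓝 (∑ j, m j * φ j x)) :=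
    tendsto_finsetSum _ fun j _ => ((hz j).mono_left hU).mul ((hφ j x hx).tendsto.comp h1)
  have h3 : Tendsto (fun n => ∑ j, z n j * φ j x₀) U (𝓝 (∑ j, m j * φ j x₀)) :=
    tendsto_finsetSum _ fun j _ => ((hz j).mono_left hU).mul_const _
  exact absurd (le_of_tendsto_of_tendsto' h3 h2 hmax) (not_le.2 (huniq x hx hne))

/-! ### The half-vectorized matrix as a function of the parameter -/

section Ups

variable {p T K q : ℕ}

theorem exists_upsOf_apply (a b : Fin (p + T - 1)) :
    ∃ ab, ∀ lam : Param p T K q, upsOf lam a b = lam (Sum.inr ab) := by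
  by_cases h : b ≤ a
  · exact ⟨⟨(a, b), h⟩, fun lam => by simp [upsOf, unvech, h]⟩
  · exact ⟨⟨(b, a), (not_le.mp h).le⟩, fun lam => by simp [upsOf, unvech, h]⟩

theorem upsOf_isHermitian (lam : Param p T K q) : (upsOf lam).IsHermitian := by
  ext a b
  rw [conjTranspose_apply, star_trivial]
  rcases lt_trichotomy a b with h | rfl | h
  · simp [upsOf, unvech, h.le, h.not_ge]
  · rfl
  · simp [upsOf, unvech, h.le, h.not_ge]

theorem upsOf_add_smul (lam v : Param p T K q) (t : ℝ) :
    upsOf (lam + t • v) = upsOf lam + t • upsOf v := by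
  ext a b
  obtain ⟨ab, h⟩ := exists_upsOf_apply (K := K) (q := q) a b
  simp [h]

theorem etaOf_add_smul (lam v : Param p T K q) (t : ℝ) :
    etaOf (lam + t • v) = etaOf lam + t • etaOf v := by
  ext c
  simp [etaOf]

theorem contDiff_upsOf_apply (a b : Fin (p + T - 1)) :
    ContDiff ℝ 2 fun lam : Param p T K q => upsOf lam a b := by
  obtain ⟨ab, h⟩ := exists_upsOf_apply (K := K) (q := q) a b
  simp_rw [h]
  fun_prop

/-- Positive definiteness is an open condition, by compactness of the unit sphere. -/
theorem isOpen_paramSpace : IsOpen (ParamSpace p T K q) := by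
  rw [isOpen_iff_eventually]
  intro lam hlam
  set S := Metric.sphere (0 : EuclideanSpace ℝ (Fin (p + T - 1))) 1
  have hcont : Continuous fun z : Param p T K q × EuclideanSpace ℝ (Fin (p + T - 1)) =>
      z.2.ofLp ⬝ᵥ (upsOf z.1 *ᵥ z.2.ofLp) := by
    simp only [dotProduct, mulVec]
    refine continuous_finsetSum _ fun a _ => Continuous.mul (by fun_prop) ?_
    refine continuous_finsetSum _ fun b _ => Continuous.mul ?_ (by fun_prop)
    exact (contDiff_upsOf_apply a b).continuous.comp continuous_fst
  have h1 : ∀ v ∈ S, ∀ᶠ z : Param p T K q × EuclideanSpace ℝ (Fin (p + T - 1)) in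
      𝓝 (lam, v), 0 < z.2.ofLp ⬝ᵥ (upsOf z.1 *ᵥ z.2.ofLp) := by
    intro v hv
    refine hcont.continuousAt.eventually (lt_mem_nhds ?_)
    have hv0 : v.ofLp ≠ 0 := by
      intro h
      have : v = 0 := by ext i; simp [h]
      simp [S, this] at hv
    simpa using (show (upsOf lam).PosDef from hlam).dotProduct_mulVec_pos hv0
  have h2 : ∀ᶠ mu in 𝓝 lam, ∀ v ∈ S, 0 < v.ofLp ⬝ᵥ (upsOf mu *ᵥ v.ofLp) :=
    (isCompact_sphere _ _).eventually_forall_of_forall_eventually h1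
  filter_upwards [h2] with mu hmu
  refine PosDef.of_dotProduct_mulVec_pos (upsOf_isHermitian mu) fun x hx => ?_
  set v : EuclideanSpace ℝ (Fin (p + T - 1)) := WithLp.toLp 2 x with hv
  have hv0 : ‖v‖ ≠ 0 := by
    rw [norm_ne_zero_iff]
    intro h
    apply hx
    have := congrArg WithLp.ofLp h
    simpa [hv] using this
  have h3 := hmu (‖v‖⁻¹ • v) (by simp [S, norm_smul, hv0])
  simp only [WithLp.ofLp_smul, mulVec_smul, dotProduct_smul, smul_dotProduct, smul_eq_mul] at h3
  have hpos : 0 < ‖v‖⁻¹ := inv_pos.2 (lt_of_le_of_ne (norm_nonneg _) hv0.symm)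
  simpa using pos_of_mul_pos_right (pos_of_mul_pos_right h3 hpos.le) hpos.le

theorem contDiff_det {n : Type*} [Fintype n] [DecidableEq n] {E : Type*} [NormedAddCommGroup E]
    [NormedSpace ℝ E] {A : E → Matrix n n ℝ} (hA : ∀ a b, ContDiff ℝ 2 fun x => A x a b) :
    ContDiff ℝ 2 fun x => (A x).det := by
  simp only [det_apply]
  exact ContDiff.sum fun σ _ => (contDiff_prod fun i _ => hA _ _).const_smul _

theorem contDiff_adjugate {n : Type*} [Fintype n] [DecidableEq n] {E : Type*}
    [NormedAddCommGroup E] [NormedSpace ℝ E] {A : E → Matrix n n ℝ}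
    (hA : ∀ a b, ContDiff ℝ 2 fun x => A x a b) (a b : n) :
    ContDiff ℝ 2 fun x => (A x).adjugate a b := by
  simp only [adjugate_apply]
  refine contDiff_det fun c d => ?_
  simp only [updateRow_apply]
  split_ifs
  · exact contDiff_const
  · exact hA c d

theorem contDiffAt_log_det {lam : Param p T K q} (h : lam ∈ ParamSpace p T K q) :
    ContDiffAt ℝ 2 (fun lam : Param p T K q => Real.log (upsOf lam).det) lam :=
  (contDiff_det contDiff_upsOf_apply).contDiffAt.log (ne_of_gt (PosDef.det_pos h))

theorem contDiffAt_inv {n : Type*} [Fintype n] [DecidableEq n] {E : Type*}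
    [NormedAddCommGroup E] [NormedSpace ℝ E] {A : E → Matrix n n ℝ}
    (hA : ∀ a b, ContDiff ℝ 2 fun x => A x a b) {x : E} (hx : (A x).det ≠ 0) (a b : n) :
    ContDiffAt ℝ 2 (fun x => (A x)⁻¹ a b) x := by
  simp only [inv_def, Ring.inverse_eq_inv', Matrix.smul_apply, smul_eq_mul]
  exact ((contDiff_det hA).contDiffAt.inv hx).mul (contDiff_adjugate hA a b).contDiffAt

theorem upsOf_mkParam {δ : Fin p → ℝ} {β : Fin K → ℝ} {μ : Fin p → ℝ}
    {θ : Fin p → Fin q → ℝ} {Υ : Matrix (Fin (p + T - 1)) (Fin (p + T - 1)) ℝ}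
    (hΥ : Υ.IsHermitian) : upsOf (mkParam δ β μ θ Υ) = Υ := by
  ext a b
  by_cases h : b ≤ a
  · simp [upsOf, unvech, mkParam, vech, h]
  · simpa [upsOf, unvech, mkParam, vech, h] using hΥ.apply a b

end Ups

/-! ### Stationarity of the Gaussian likelihood in the covariance matrix -/

theorem hasDerivAt_det_one_add_smul {n : Type*} [Fintype n] [DecidableEq n] (M : Matrix n n ℝ) :
    HasDerivAt (fun t : ℝ => (1 + t • M).det) M.trace 0 := by
  obtain ⟨Q, hQ⟩ : ∃ Q : Polynomial ℝ, ∀ t : ℝ,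
      (1 + t • M).det = 1 + M.trace * t + Q.eval t * t ^ 2 := ⟨_, fun t => det_one_add_smul t M⟩
  simp_rw [hQ]
  have h1 : HasDerivAt (fun t : ℝ => 1 + M.trace * t) M.trace 0 := by
    simpa using ((hasDerivAt_id (0 : ℝ)).const_mul M.trace).const_add 1
  have h2 : HasDerivAt (fun t : ℝ => Q.eval t * t ^ 2) 0 0 := by
    simpa using (Q.hasDerivAt 0).fun_mul (hasDerivAt_pow 2 (0 : ℝ))
  simpa using h1.fun_add h2

theorem hasDerivAt_trace_inv_one_add_smul {n : Type*} [Fintype n] [DecidableEq n]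
    (M : Matrix n n ℝ) :
    HasDerivAt (fun t : ℝ => (1 + t • M)⁻¹.trace) (-M.trace) 0 := by
  have hent : ∀ a b, ContDiff ℝ 2 fun t : ℝ => (1 + t • M) a b := fun a b => by
    simp only [Matrix.add_apply, Matrix.smul_apply, smul_eq_mul]
    fun_prop
  have hdet : ((1 : Matrix n n ℝ) + (0 : ℝ) • M).det ≠ 0 := by simp
  have hinv : ∀ a b, DifferentiableAt ℝ (fun t : ℝ => (1 + t • M)⁻¹ a b) 0 := fun a b =>
    (contDiffAt_inv hent hdet a b).differentiableAt (by norm_num)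
  -- `R (1 + t M) = 1` gives `tr R = n - t tr (R M)` for the inverse `R`
  have hk : DifferentiableAt ℝ (fun t : ℝ => ((1 + t • M)⁻¹ * M).trace) 0 := by
    simp only [trace, diag_apply, mul_apply]
    exact DifferentiableAt.fun_sum fun a _ => DifferentiableAt.fun_sum fun b _ =>
      (hinv a b).mul_const _
  have h1 := ((hasDerivAt_id (0 : ℝ)).mul hk.hasDerivAt).const_sub (Fintype.card n : ℝ)
  have h2 : -M.trace = -(1 * ((1 + (0 : ℝ) • M)⁻¹ * M).trace +
      id (0 : ℝ) * deriv (fun t : ℝ => ((1 + t • M)⁻¹ * M).trace) 0) := by simp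
  rw [h2]
  refine h1.congr_of_eventuallyEq ?_
  filter_upwards [(contDiff_det hent).continuous.continuousAt.eventually_ne hdet] with t ht
  have h3 := congrArg trace (nonsing_inv_mul (1 + t • M) (isUnit_iff_ne_zero.2 ht))
  rw [mul_add, mul_one, trace_add, mul_smul_comm, trace_smul, trace_one, smul_eq_mul] at h3
  simp only [Pi.mul_apply, id]
  linarith

/-- `Υ ↦ ln |Υ| + tr (Υ⁻¹ A)` is stationary at `Υ = A`. -/
theorem hasDerivAt_log_det_add_trace {n : Type*} [Fintype n] [DecidableEq n] {A : Matrix n n ℝ}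
    (hA : A.det ≠ 0) (V : Matrix n n ℝ) :
    HasDerivAt (fun t : ℝ => Real.log (A + t • V).det + ((A + t • V)⁻¹ * A).trace) 0 0 := by
  have hu : IsUnit A.det := isUnit_iff_ne_zero.2 hA
  set M := A⁻¹ * V with hM
  have hfac : ∀ t : ℝ, A + t • V = A * (1 + t • M) := by
    intro t
    rw [mul_add, mul_one, mul_smul_comm, hM, mul_nonsing_inv_cancel_left _ _ hu]
  have h1 : ∀ t : ℝ, (A + t • V)⁻¹ * A = (1 + t • M)⁻¹ := by
    intro t
    rw [hfac, Matrix.mul_inv_rev, Matrix.mul_assoc, nonsing_inv_mul _ hu, mul_one]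
  have h2 : ∀ t : ℝ, (A + t • V).det = A.det * (1 + t • M).det := by
    intro t; rw [hfac, det_mul]
  simp_rw [h1, h2]
  have h3 := ((hasDerivAt_det_one_add_smul M).const_mul A.det).log (by simpa using hA)
  have h4 := h3.fun_add (hasDerivAt_trace_inv_one_add_smul M)
  have h5 : A.det * M.trace / (A.det * (1 + (0 : ℝ) • M).det) + -M.trace = 0 := by
    rw [zero_smul, add_zero, det_one, mul_one, mul_div_cancel_left₀ _ hA, add_neg_cancel]
  rwa [h5] at h4

/-! ### The likelihood as a linear function of cross products of the data -/

section Decomposition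

variable {Ω : Type*} {p T K q : ℕ}

/-- The coefficient vector `(1, η')'`. -/
def augCoef (lam : Param p T K q) : Option (EtaIdx p K q) → ℝ
  | none => 1
  | some c => etaOf lam c

/-- The variables `(ỹ_i, -W̃_i)` in row `a` of the system, so that `ũ_i(η)` is their linear
combination with coefficients `(1, η')'`. -/
def Panel.augReg (D : Panel Ω K q) (p T : ℕ) (a : Fin (p + T - 1)) :
    Option (EtaIdx p K q) → ℕ → Ω → ℝ
  | none => fun i ω => D.yTilde p T i ω a
  | some c => fun i ω => -D.wTilde p T i ω a c

theorem Panel.resid_apply (D : Panel Ω K q) (i : ℕ) (lam : Param p T K q) (ω : Ω)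
    (a : Fin (p + T - 1)) :
    D.resid p T i (etaOf lam) ω a = ∑ c, augCoef lam c * D.augReg p T a c i ω := by
  rw [Fintype.sum_option]
  simp only [resid, Pi.sub_apply, mulVec, dotProduct, augCoef, augReg, one_mul, mul_neg,
    Finset.sum_neg_distrib, sub_eq_add_neg]
  simp only [mul_comm]

/-- Positions of the cross products of the variables of the system; `none` is the constant. -/
abbrev QuadIdx (p T K q : ℕ) : Type :=
  Option ((Fin (p + T - 1) × Fin (p + T - 1)) ×
    (Option (EtaIdx p K q) × Option (EtaIdx p K q)))

/-- The coefficient of a cross product of the data in the quasi log-likelihood, as a function of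
the parameter. -/
def quadCoef : QuadIdx p T K q → Param p T K q → ℝ
  | none => fun lam => -(((T : ℝ) + p - 1) / 2) * Real.log (2 * Real.pi)
      - 1 / 2 * Real.log (upsOf lam).det
  | some j => fun lam =>
      -(1 / 2) * ((upsOf lam)⁻¹ j.1.1 j.1.2 * (augCoef lam j.2.1 * augCoef lam j.2.2))

/-- The cross products of the data of individual `i`. -/
def Panel.cross (D : Panel Ω K q) : QuadIdx p T K q → ℕ → Ω → ℝ
  | none => fun _ _ => 1
  | some j => fun i ω => D.augReg p T j.1.1 j.2.1 i ω * D.augReg p T j.1.2 j.2.2 i ω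

/-- The averages of the cross products over the first `N` individuals. -/
def Panel.avgCross (D : Panel Ω K q) (N : ℕ) (ω : Ω) (j : QuadIdx p T K q) : ℝ :=
  (N : ℝ)⁻¹ * ∑ i ∈ Finset.range N, D.cross j i ω

theorem sum_pair_pair {α β : Type*} [Fintype α] [Fintype β] (f : (α × α) × (β × β) → ℝ) :
    ∑ j, f j = ∑ a, ∑ b, ∑ c, ∑ d, f ((a, b), (c, d)) := by
  simp only [Fintype.sum_prod_type]

theorem sum_quadCoef (z : QuadIdx p T K q → ℝ) (lam : Param p T K q) :
    ∑ j, z j * quadCoef j lam = z none * quadCoef none lam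
      - 1 / 2 * ∑ a, ∑ b, (upsOf lam)⁻¹ a b *
        ∑ c, ∑ d, augCoef lam c * augCoef lam d * z (some ((a, b), (c, d))) := by
  rw [Fintype.sum_option, sum_pair_pair, sub_eq_add_neg, ← neg_mul]
  simp only [Finset.mul_sum]
  refine congrArg (z none * quadCoef none lam + ·) ?_
  refine Finset.sum_congr rfl fun a _ => Finset.sum_congr rfl fun b _ =>
    Finset.sum_congr rfl fun c _ => Finset.sum_congr rfl fun d _ => ?_
  simp only [quadCoef]
  ring

theorem Panel.sum_cross (D : Panel Ω K q) (i : ℕ) (lam : Param p T K q) (ω : Ω)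
    (a b : Fin (p + T - 1)) :
    ∑ c, ∑ d, augCoef lam c * augCoef lam d * D.cross (some ((a, b), (c, d))) i ω =
      D.resid p T i (etaOf lam) ω a * D.resid p T i (etaOf lam) ω b := by
  rw [resid_apply, resid_apply, Finset.sum_mul_sum]
  refine Finset.sum_congr rfl fun c _ => Finset.sum_congr rfl fun d _ => ?_
  simp only [cross]
  ring

theorem Panel.qll_eq_sum (D : Panel Ω K q) (i : ℕ) (ω : Ω) (lam : Param p T K q) :
    D.qll p T i ω lam = ∑ j, D.cross j i ω * quadCoef j lam := by
  rw [sum_quadCoef]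
  simp only [sum_cross]
  simp only [qll, cross, quadCoef, one_mul, dotProduct, mulVec, Finset.mul_sum]
  congr 1
  refine Finset.sum_congr rfl fun a _ => Finset.sum_congr rfl fun b _ => ?_
  ring

theorem Panel.avgQll_eq_sum (D : Panel Ω K q) (N : ℕ) (ω : Ω) :
    D.avgQll p T N ω = fun lam => ∑ j, D.avgCross N ω j * quadCoef j lam := by
  ext lam
  simp only [avgQll, qll_eq_sum, avgCross, mul_assoc, Finset.sum_mul]
  rw [Finset.sum_comm]
  simp only [Finset.mul_sum]

theorem contDiff_augCoef (c : Option (EtaIdx p K q)) :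
    ContDiff ℝ 2 fun lam : Param p T K q => augCoef lam c := by
  cases c with
  | none => exact contDiff_const
  | some c => simp only [augCoef, etaOf]; fun_prop

theorem contDiffAt_quadCoef {lam : Param p T K q} (h : lam ∈ ParamSpace p T K q)
    (j : QuadIdx p T K q) : ContDiffAt ℝ 2 (quadCoef j) lam := by
  cases j with
  | none =>
    simp only [quadCoef]
    exact contDiffAt_const.sub (contDiffAt_const.mul (contDiffAt_log_det h))
  | some j =>
    simp only [quadCoef]
    exact contDiffAt_const.mul
      ((contDiffAt_inv contDiff_upsOf_apply (ne_of_gt (PosDef.det_pos h)) _ _).mul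
      ((contDiff_augCoef _).contDiffAt.mul (contDiff_augCoef _).contDiffAt))

theorem contDiffAt_sum_quadCoef (z : QuadIdx p T K q → ℝ) {lam : Param p T K q}
    (h : lam ∈ ParamSpace p T K q) :
    ContDiffAt ℝ 2 (fun lam => ∑ j, z j * quadCoef j lam) lam :=
  ContDiffAt.sum fun j _ => contDiffAt_const.mul (contDiffAt_quadCoef h j)

theorem fderiv_sum_quadCoef (z : QuadIdx p T K q → ℝ) {lam : Param p T K q}
    (h : lam ∈ ParamSpace p T K q) :
    fderiv ℝ (fun lam => ∑ j, z j * quadCoef j lam) lam =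
      ∑ j, z j • fderiv ℝ (quadCoef j) lam := by
  have hd : ∀ j, DifferentiableAt ℝ (quadCoef j) lam := fun j =>
    (contDiffAt_quadCoef h j).differentiableAt (by norm_num)
  rw [fderiv_fun_sum fun j _ => (hd j).const_mul _]
  exact Finset.sum_congr rfl fun j _ => fderiv_const_mul (hd j) _

theorem fderiv_fderiv_sum_quadCoef (z : QuadIdx p T K q → ℝ) {lam : Param p T K q}
    (h : lam ∈ ParamSpace p T K q) :
    fderiv ℝ (fderiv ℝ fun lam => ∑ j, z j * quadCoef j lam) lam =
      ∑ j, z j • fderiv ℝ (fderiv ℝ (quadCoef j)) lam := by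
  have hd : ∀ j, DifferentiableAt ℝ (fderiv ℝ (quadCoef j)) lam := fun j =>
    ((contDiffAt_quadCoef h j).fderiv_right (m := 1) (by norm_num)).differentiableAt (by norm_num)
  have heq : (fderiv ℝ fun lam => ∑ j, z j * quadCoef j lam) =ᶠ[𝓝 lam]
      fun lam => ∑ j, z j • fderiv ℝ (quadCoef j) lam := by
    filter_upwards [isOpen_paramSpace.mem_nhds h] with mu hmu using fderiv_sum_quadCoef z hmu
  rw [heq.fderiv_eq]
  exact (HasFDerivAt.fun_sum fun j _ => (hd j).hasFDerivAt.const_smul (z j)).fderiv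

/-- The second partial derivatives of `∑ z_j φ_j` with the coefficient functions `φ_j` of the
likelihood. -/
def hessComb (z : QuadIdx p T K q → ℝ) (lam : Param p T K q) :
    Matrix (ParamIdx p T K q) (ParamIdx p T K q) ℝ :=
  Matrix.of fun a b => ∑ j, z j * fderiv ℝ (fderiv ℝ (quadCoef j)) lam
    (EuclideanSpace.single a 1) (EuclideanSpace.single b 1)

theorem hessComb_apply (z : QuadIdx p T K q → ℝ) {lam : Param p T K q}
    (h : lam ∈ ParamSpace p T K q) (a b : ParamIdx p T K q) :
    hessComb z lam a b = fderiv ℝ (fderiv ℝ fun lam => ∑ j, z j * quadCoef j lam) lam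
      (EuclideanSpace.single a 1) (EuclideanSpace.single b 1) := by
  rw [fderiv_fderiv_sum_quadCoef z h]
  simp [hessComb]

theorem Panel.avgHessian_eq (D : Panel Ω K q) (N : ℕ) (ω : Ω) {lam : Param p T K q}
    (h : lam ∈ ParamSpace p T K q) :
    D.avgHessian p T N ω lam = hessComb (D.avgCross N ω) lam := by
  ext a b
  rw [hessComb_apply _ h, avgHessian, avgQll_eq_sum, of_apply]
  have hd : DifferentiableAt ℝ
      (fderiv ℝ fun lam => ∑ j, D.avgCross N ω j * quadCoef j lam) lam :=
    ((contDiffAt_sum_quadCoef _ h).fderiv_right (m := 1)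
      (by norm_num)).differentiableAt (by norm_num)
  rw [fderiv_clm_apply hd (differentiableAt_const _)]
  simp

/-- If `-H` is positive definite for the matrix `H` of second derivatives, then the second
derivative is a negative definite form. -/
theorem fderiv_fderiv_neg_of_posDef {z : QuadIdx p T K q → ℝ} {lam : Param p T K q}
    (h : lam ∈ ParamSpace p T K q) (hH : (-(hessComb z lam)).PosDef) (v : Param p T K q)
    (hv : v ≠ 0) :
    fderiv ℝ (fderiv ℝ fun lam => ∑ j, z j * quadCoef j lam) lam v v < 0 := by
  set B := fderiv ℝ (fderiv ℝ fun lam => ∑ j, z j * quadCoef j lam) lam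
  have hv0 : v.ofLp ≠ 0 := fun h0 => hv (by ext i; simp [h0])
  have h1 := hH.dotProduct_mulVec_pos hv0
  rw [star_trivial, neg_mulVec, dotProduct_neg] at h1
  have hsum : v = ∑ a, v a • EuclideanSpace.single a (1 : ℝ) := by
    simpa using ((EuclideanSpace.basisFun (ParamIdx p T K q) ℝ).sum_repr v).symm
  have h2 : B v v = v.ofLp ⬝ᵥ (hessComb z lam *ᵥ v.ofLp) := by
    have h3 : ∀ w, B w v = ∑ b, v b * B w (EuclideanSpace.single b 1) := fun w => by
      conv_lhs => rw [hsum]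
      simp only [map_sum, map_smul, smul_eq_mul]
    have h4 : ∀ u, B v u = ∑ a, v a * B (EuclideanSpace.single a 1) u := fun u => by
      conv_lhs => rw [hsum]
      simp only [map_sum, map_smul, _root_.sum_apply, _root_.smul_apply, smul_eq_mul]
    rw [h4, dotProduct]
    refine Finset.sum_congr rfl fun a _ => ?_
    rw [h3, mulVec, dotProduct]
    refine congrArg _ (Finset.sum_congr rfl fun b _ => ?_)
    rw [hessComb_apply z h, mul_comm]
  linarith

end Decomposition

/-! ### Sequences of random variables with bounded moments -/

section Sequences

variable {Ω : Type*} [MeasurableSpace Ω] {P : Measure Ω}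

/-- The absolute moments of order `s` are finite and uniformly bounded along the sequence. -/
def BddMoment (P : Measure Ω) (s : ℝ) (f : ℕ → Ω → ℝ) : Prop :=
  ∃ M : ℝ, ∀ i, Integrable (fun ω => |f i ω| ^ s) P ∧ ∫ ω, |f i ω| ^ s ∂P ≤ M

/-- Domination of a moment of order `r` by moments of order `s` of two other sequences. -/
theorem bddMoment_of_le {s r A : ℝ} {f g h : ℕ → Ω → ℝ} (hf : BddMoment P s f)
    (hg : BddMoment P s g) (hA : 0 ≤ A) (hm : ∀ i, Measurable (h i))
    (hle : ∀ i ω, |h i ω| ^ r ≤ A * (|f i ω| ^ s + |g i ω| ^ s)) : BddMoment P r h := by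
  obtain ⟨M, hM⟩ := hf
  obtain ⟨L, hL⟩ := hg
  have hint : ∀ i, Integrable (fun ω => A * (|f i ω| ^ s + |g i ω| ^ s)) P := fun i =>
    ((hM i).1.add (hL i).1).const_mul A
  have hh : ∀ i, Integrable (fun ω => |h i ω| ^ r) P := fun i =>
    (hint i).mono' ((hm i).abs.pow_const r).aestronglyMeasurable (Eventually.of_forall fun ω => by
      rw [Real.norm_of_nonneg (by positivity)]
      exact hle i ω)
  refine ⟨A * (M + L), fun i => ⟨hh i, (integral_mono (hh i) (hint i) (hle i)).trans ?_⟩⟩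
  rw [integral_const_mul, integral_add (hM i).1 (hL i).1]
  exact mul_le_mul_of_nonneg_left (add_le_add (hM i).2 (hL i).2) hA

theorem BddMoment.add {s : ℝ} (hs : 0 ≤ s) {f g : ℕ → Ω → ℝ} (hf : BddMoment P s f)
    (hg : BddMoment P s g) (hfm : ∀ i, Measurable (f i)) (hgm : ∀ i, Measurable (g i)) :
    BddMoment P s (f + g) := by
  refine bddMoment_of_le hf hg (A := 2 ^ s) (by positivity) (fun i => (hfm i).add (hgm i))
    fun i ω => ?_
  rw [mul_add, ← Real.mul_rpow (by norm_num) (abs_nonneg _),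
    ← Real.mul_rpow (by norm_num) (abs_nonneg _)]
  simp only [Pi.add_apply]
  have h1 := abs_add_le (f i ω) (g i ω)
  have hf0 : 0 ≤ (2 * |f i ω|) ^ s := by positivity
  have hg0 : 0 ≤ (2 * |g i ω|) ^ s := by positivity
  rcases le_total |f i ω| |g i ω| with h | h
  · have := Real.rpow_le_rpow (abs_nonneg _) (show |f i ω + g i ω| ≤ 2 * |g i ω| by linarith) hs
    linarith
  · have := Real.rpow_le_rpow (abs_nonneg _) (show |f i ω + g i ω| ≤ 2 * |f i ω| by linarith) hs
    linarith

theorem BddMoment.smul {s : ℝ} {f : ℕ → Ω → ℝ} (hf : BddMoment P s f) (c : ℝ) :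
    BddMoment P s (c • f) := by
  obtain ⟨M, hM⟩ := hf
  have h : ∀ i ω, |(c • f) i ω| ^ s = |c| ^ s * |f i ω| ^ s := fun i ω => by
    simp only [Pi.smul_apply, smul_eq_mul, abs_mul]
    exact Real.mul_rpow (abs_nonneg _) (abs_nonneg _)
  refine ⟨|c| ^ s * M, fun i => ?_⟩
  simp only [h]
  refine ⟨(hM i).1.const_mul _, ?_⟩
  rw [integral_const_mul]
  exact mul_le_mul_of_nonneg_left (hM i).2 (by positivity)

/-- The product of two sequences has bounded moments of half the order. -/
theorem BddMoment.mul {s : ℝ} (hs : 0 ≤ s) {f g : ℕ → Ω → ℝ} (hf : BddMoment P s f)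
    (hg : BddMoment P s g) (hfm : ∀ i, Measurable (f i)) (hgm : ∀ i, Measurable (g i)) :
    BddMoment P (s / 2) (f * g) := by
  refine bddMoment_of_le hf hg (A := 1) zero_le_one (fun i => (hfm i).mul (hgm i)) fun i ω => ?_
  simp only [Pi.mul_apply, abs_mul, one_mul]
  have key : ∀ x : ℝ, 0 ≤ x → (x * x) ^ (s / 2) = x ^ s := fun x hx => by
    rw [← sq, ← Real.rpow_natCast, ← Real.rpow_mul hx]
    congr 1
    push_cast
    ring
  have hf0 : 0 ≤ |f i ω| ^ s := by positivity
  have hg0 : 0 ≤ |g i ω| ^ s := by positivity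
  have ha := abs_nonneg (f i ω)
  have hb := abs_nonneg (g i ω)
  rcases le_total |f i ω| |g i ω| with h | h
  · have := Real.rpow_le_rpow (mul_nonneg ha hb) (mul_le_mul_of_nonneg_right h hb)
      (by linarith : 0 ≤ s / 2)
    rw [key _ hb] at this
    linarith
  · have := Real.rpow_le_rpow (mul_nonneg ha hb) (mul_le_mul_of_nonneg_left h ha)
      (by linarith : 0 ≤ s / 2)
    rw [key _ ha] at this
    linarith

theorem BddMoment.memLp [IsProbabilityMeasure P] {s : ℝ} (hs : 2 ≤ s) {f : ℕ → Ω → ℝ}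
    (hf : BddMoment P s f) (hfm : ∀ i, Measurable (f i)) (i : ℕ) : MemLp (f i) 2 P := by
  obtain ⟨M, hM⟩ := hf
  have h0 : 0 < s := by linarith
  have h1 : MemLp (f i) (ENNReal.ofReal s) P := by
    rw [← integrable_norm_rpow_iff (hfm i).aestronglyMeasurable
      (by simpa using h0) ENNReal.ofReal_ne_top, ENNReal.toReal_ofReal h0.le]
    exact (hM i).1
  refine h1.mono_exponent ?_
  rw [← ENNReal.ofReal_ofNat]
  exact ENNReal.ofReal_le_ofReal hs

/-- The averages of the expected products of two sequences converge. -/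
def HasProductLimit (P : Measure Ω) (f g : ℕ → Ω → ℝ) : Prop :=
  ∃ c : ℝ, Tendsto (fun N : ℕ => (N : ℝ)⁻¹ * ∑ i ∈ Finset.range N, ∫ ω, f i ω * g i ω ∂P)
    atTop (𝓝 c)

theorem HasProductLimit.symm {f g : ℕ → Ω → ℝ} (h : HasProductLimit P f g) :
    HasProductLimit P g f := by
  obtain ⟨c, hc⟩ := h
  exact ⟨c, by simpa only [mul_comm (g _ _)] using hc⟩

theorem HasProductLimit.add_left {f₁ f₂ g : ℕ → Ω → ℝ} (h₁ : HasProductLimit P f₁ g)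
    (h₂ : HasProductLimit P f₂ g) (hf₁ : ∀ i, MemLp (f₁ i) 2 P) (hf₂ : ∀ i, MemLp (f₂ i) 2 P)
    (hg : ∀ i, MemLp (g i) 2 P) : HasProductLimit P (f₁ + f₂) g := by
  obtain ⟨c₁, hc₁⟩ := h₁
  obtain ⟨c₂, hc₂⟩ := h₂
  refine ⟨c₁ + c₂, (hc₁.add hc₂).congr fun N => ?_⟩
  rw [← mul_add, ← Finset.sum_add_distrib]
  congr 1
  refine Finset.sum_congr rfl fun i _ => ?_
  simp only [Pi.add_apply, add_mul]
  exact (integral_add ((hf₁ i).integrable_mul (hg i)) ((hf₂ i).integrable_mul (hg i))).symm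

theorem HasProductLimit.smul_left {f g : ℕ → Ω → ℝ} (h : HasProductLimit P f g) (a : ℝ) :
    HasProductLimit P (a • f) g := by
  obtain ⟨c, hc⟩ := h
  refine ⟨a * c, (hc.const_mul a).congr fun N => ?_⟩
  simp only [Pi.smul_apply, smul_eq_mul, mul_assoc, integral_const_mul, ← Finset.mul_sum]
  ring

theorem hasProductLimit_zero_left (g : ℕ → Ω → ℝ) : HasProductLimit P 0 g :=
  ⟨0, by simp⟩

/-- Convergence of average products extends from generators to their linear spans. -/
theorem HasProductLimit.of_mem_span {G : Set (ℕ → Ω → ℝ)}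
    (hL2 : ∀ f ∈ Submodule.span ℝ G, ∀ i, MemLp (f i) 2 P)
    (hG : ∀ f ∈ G, ∀ g ∈ G, HasProductLimit P f g) {f g : ℕ → Ω → ℝ}
    (hf : f ∈ Submodule.span ℝ G) (hg : g ∈ Submodule.span ℝ G) : HasProductLimit P f g := by
  induction hf, hg using Submodule.span_induction₂ with
  | mem_mem x y hx hy => exact hG x hx y hy
  | zero_left y hy => exact hasProductLimit_zero_left y
  | zero_right x hx => exact (hasProductLimit_zero_left x).symm
  | add_left x y z hx hy hz h1 h2 =>
    exact h1.add_left h2 (hL2 x hx) (hL2 y hy) (hL2 z hz)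
  | add_right x y z hx hy hz h1 h2 =>
    exact (h1.symm.add_left h2.symm (hL2 y hy) (hL2 z hz) (hL2 x hx)).symm
  | smul_left r x y hx hy h => exact h.smul_left r
  | smul_right r x y hx hy h => exact (h.symm.smul_left r).symm

end Sequences

/-! ### The spans of the levels and of the differences -/

section Spans

variable {Ω : Type*} {K q : ℕ}

/-- The data in levels: `y_{it}` for `1 - p ≤ t ≤ T` and the entries of `x_i`. -/
def Panel.levels (D : Panel Ω K q) (p T : ℕ) : Set (ℕ → Ω → ℝ) :=
  {f | (∃ t ∈ Set.Icc (1 - (p : ℤ)) T, f = fun i => D.y i t) ∨ ∃ l, f = fun i => D.x i l}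

/-- The variables of the differenced system: the constant, the `Δy_{it}` and the entries of
`x_i`. -/
def Panel.diffs (D : Panel Ω K q) (p T : ℕ) : Set (ℕ → Ω → ℝ) :=
  {f | f = (fun _ _ => 1) ∨ (∃ a < p + T - 1, f = fun i => D.dy i (rowTime p a)) ∨
    ∃ l, f = fun i => D.x i l}

theorem rowTime_mem {p T a : ℕ} (ha : a < p + T - 1) :
    rowTime p a ∈ Set.Icc (1 - (p : ℤ)) T ∧ rowTime p a - 1 ∈ Set.Icc (1 - (p : ℤ)) T := by
  simp only [rowTime, Set.mem_Icc]
  omega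

theorem rowTime_sub {p a j : ℕ} (h : j + 1 ≤ a) :
    rowTime p a - ((j : ℤ) + 1) = rowTime p (a - (j + 1)) := by
  simp only [rowTime]
  omega

variable (D : Panel Ω K q) {p T : ℕ}

theorem Panel.y_mem_levels {t : ℤ} (ht : t ∈ Set.Icc (1 - (p : ℤ)) T) :
    (fun i => D.y i t) ∈ D.levels p T := Or.inl ⟨t, ht, rfl⟩

theorem Panel.x_mem_levels (l : Fin q) : (fun i => D.x i l) ∈ D.levels p T := Or.inr ⟨l, rfl⟩

theorem Panel.dy_mem_span_levels {a : ℕ} (ha : a < p + T - 1) :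
    (fun i => D.dy i (rowTime p a)) ∈ Submodule.span ℝ (D.levels p T) :=
  Submodule.sub_mem _ (Submodule.subset_span (D.y_mem_levels (rowTime_mem ha).1))
    (Submodule.subset_span (D.y_mem_levels (rowTime_mem ha).2))

theorem Panel.one_mem_diffs : (fun _ _ => 1 : ℕ → Ω → ℝ) ∈ D.diffs p T := Or.inl rfl

theorem Panel.dy_mem_diffs {a : ℕ} (ha : a < p + T - 1) :
    (fun i => D.dy i (rowTime p a)) ∈ D.diffs p T := Or.inr (Or.inl ⟨a, ha, rfl⟩)

theorem Panel.x_mem_diffs (l : Fin q) : (fun i => D.x i l) ∈ D.diffs p T :=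
  Or.inr (Or.inr ⟨l, rfl⟩)

theorem Panel.dx_mem_span (t : ℤ) (k : Fin K) :
    (fun i => D.dx i t k) ∈ Submodule.span ℝ (D.diffs p T) :=
  Submodule.sub_mem _ (Submodule.subset_span (D.x_mem_diffs _))
    (Submodule.subset_span (D.x_mem_diffs _))

/-- All entries of `(ỹ_i, -W̃_i)` are linear combinations of the constant, the `Δy_{it}` and the
entries of `x_i`. -/
theorem Panel.augReg_mem_span (a : Fin (p + T - 1)) (c : Option (EtaIdx p K q)) :
    D.augReg p T a c ∈ Submodule.span ℝ (D.diffs p T) := by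
  have hzero : (fun _ _ => 0 : ℕ → Ω → ℝ) ∈ Submodule.span ℝ (D.diffs p T) :=
    Submodule.zero_mem _
  rcases c with _ | c
  · exact Submodule.subset_span (D.dy_mem_diffs a.2)
  · refine Submodule.neg_mem (p := Submodule.span ℝ (D.diffs p T))
      (x := fun i ω => D.wTilde p T i ω a c) ?_
    rcases c with j | k | ⟨m, u | l⟩
    · by_cases h : (a : ℕ) < p
      · simpa [wTilde, h] using hzero
      · simp only [wTilde, h, of_apply, if_false]
        rw [rowTime_sub (by omega)]
        exact Submodule.subset_span (D.dy_mem_diffs (by omega))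
    · by_cases h : (a : ℕ) < p
      · simpa [wTilde, h] using hzero
      · simp only [wTilde, h, of_apply, if_false]
        exact D.dx_mem_span _ _
    · by_cases h : (a : ℕ) = m
      · simp only [wTilde, h, of_apply, if_true]
        exact Submodule.subset_span D.one_mem_diffs
      · simpa [wTilde, h] using hzero
    · by_cases h : (a : ℕ) = m
      · simp only [wTilde, h, of_apply, if_true]
        exact Submodule.subset_span (D.x_mem_diffs l)
      · simpa [wTilde, h] using hzero

/-- The variables of the differenced system are functions of the observations on individual
`i`. -/
theorem Panel.measurable_comap_obs {f : ℕ → Ω → ℝ}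
    (hf : f ∈ Submodule.span ℝ (D.diffs p T)) (i : ℕ) :
    Measurable[MeasurableSpace.comap (D.obs p T i) inferInstance] (f i) := by
  have hobs : Measurable[MeasurableSpace.comap (D.obs p T i) inferInstance] (D.obs p T i) :=
    comap_measurable _
  have hyt : ∀ t ∈ Set.Icc (1 - (p : ℤ)) T,
      Measurable[MeasurableSpace.comap (D.obs p T i) inferInstance] (D.y i t) := fun t ht =>
    (measurable_pi_apply (⟨t, ht⟩ : Set.Icc (1 - (p : ℤ)) (T : ℤ))).comp
      (measurable_snd.comp hobs)
  induction hf using Submodule.span_induction with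
  | mem f hf =>
    rcases hf with rfl | ⟨a, ha, rfl⟩ | ⟨l, rfl⟩
    · exact measurable_const
    · exact (hyt _ (rowTime_mem ha).1).sub (hyt _ (rowTime_mem ha).2)
    · exact (measurable_pi_apply l).comp (measurable_fst.comp hobs)
  | zero => exact measurable_const
  | add f g _ _ h1 h2 => exact h1.add h2
  | smul c f _ h => exact h.const_smul c

variable [MeasurableSpace Ω] {P : Measure Ω}

theorem Panel.measurable_obs (hy : ∀ i : ℕ, ∀ t ∈ Set.Icc (1 - (p : ℤ)) T, Measurable (D.y i t))
    (hx : ∀ (i : ℕ) (l : Fin q), Measurable (D.x i l)) (i : ℕ) : Measurable (D.obs p T i) :=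
  (measurable_pi_lambda _ fun l => hx i l).prodMk (measurable_pi_lambda _ fun t => hy i t t.2)

theorem Panel.measurable_of_mem_span
    (hy : ∀ i : ℕ, ∀ t ∈ Set.Icc (1 - (p : ℤ)) T, Measurable (D.y i t))
    (hx : ∀ (i : ℕ) (l : Fin q), Measurable (D.x i l)) {f : ℕ → Ω → ℝ}
    (hf : f ∈ Submodule.span ℝ (D.diffs p T)) (i : ℕ) : Measurable (f i) :=
  (D.measurable_comap_obs hf i).mono (D.measurable_obs hy hx i).comap_le le_rfl


/-- One order `s > 2` for which the levels and the differences have bounded moments. -/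
theorem Panel.exists_bddMoment [IsProbabilityMeasure P] (hmoment : D.MomentBound P p T)
    (hloc : ∀ l : Fin q, ∃ t ∈ Set.Icc (1 : ℤ) T, ∃ k : Fin K, D.loc t k = l)
    (hy : ∀ i : ℕ, ∀ t ∈ Set.Icc (1 - (p : ℤ)) T, Measurable (D.y i t))
    (hx : ∀ (i : ℕ) (l : Fin q), Measurable (D.x i l)) :
    ∃ s > (2 : ℝ), (∀ f ∈ Submodule.span ℝ (D.levels p T), BddMoment P s f ∧
        ∀ i, Measurable (f i)) ∧
      ∀ f ∈ Submodule.span ℝ (D.diffs p T), BddMoment P s f := by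
  obtain ⟨ε, hε, M, hyM, hxM⟩ := hmoment
  have hs : 0 ≤ 2 + ε := by linarith
  have hyb : ∀ t ∈ Set.Icc (1 - (p : ℤ)) T, BddMoment P (2 + ε) fun i => D.y i t := fun t ht =>
    ⟨M, fun i => ⟨(hyM i t ht).1, (hyM i t ht).2.le⟩⟩
  have hxb : ∀ l, BddMoment P (2 + ε) fun i => D.x i l := fun l => by
    obtain ⟨t, ht, k, rfl⟩ := hloc l
    exact ⟨M, fun i => ⟨(hxM i t ht k).1, (hxM i t ht k).2.le⟩⟩
  have hconst : ∀ c : ℝ, BddMoment P (2 + ε) fun _ _ => c := fun c =>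
    ⟨|c| ^ (2 + ε), fun _ => ⟨integrable_const _, by simp⟩⟩
  have hlev : ∀ f ∈ Submodule.span ℝ (D.levels p T), BddMoment P (2 + ε) f ∧
      ∀ i, Measurable (f i) := by
    intro f hf
    induction hf using Submodule.span_induction with
    | mem f hf =>
      rcases hf with ⟨t, ht, rfl⟩ | ⟨l, rfl⟩
      · exact ⟨hyb t ht, fun i => hy i t ht⟩
      · exact ⟨hxb l, fun i => hx i l⟩
    | zero => exact ⟨hconst 0, fun i => measurable_const⟩
    | add f g _ _ h1 h2 => exact ⟨h1.1.add hs h2.1 h1.2 h2.2, fun i => (h1.2 i).add (h2.2 i)⟩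
    | smul c f _ h => exact ⟨h.1.smul c, fun i => (h.2 i).const_smul c⟩
  refine ⟨2 + ε, by linarith, hlev, fun f hf => ?_⟩
  induction hf using Submodule.span_induction with
  | mem f hf =>
    rcases hf with rfl | ⟨a, ha, rfl⟩ | ⟨l, rfl⟩
    · exact hconst 1
    · exact (hlev _ (D.dy_mem_span_levels ha)).1
    · exact hxb l
  | zero => exact hconst 0
  | add f g hf hg h1 h2 =>
    exact h1.add hs h2 (D.measurable_of_mem_span hy hx hf) (D.measurable_of_mem_span hy hx hg)
  | smul c f _ h => exact h.smul c

/-- The averaged second moments of the variables of the differenced system converge. The limits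
that involve the constant exist because the means are the same for all individuals. -/
theorem Panel.hasProductLimit (hlim : D.MomentLimits P p T)
    (hloc : ∀ l : Fin q, ∃ t ∈ Set.Icc (1 : ℤ) T, ∃ k : Fin K, D.loc t k = l)
    (hlev : ∀ f ∈ Submodule.span ℝ (D.levels p T), ∀ i, MemLp (f i) 2 P)
    (hdiff : ∀ f ∈ Submodule.span ℝ (D.diffs p T), ∀ i, MemLp (f i) 2 P)
    (hmean : ∀ f ∈ D.diffs p T, ∃ m, ∀ i, ∫ ω, f i ω ∂P = m)
    {f g : ℕ → Ω → ℝ} (hf : f ∈ Submodule.span ℝ (D.diffs p T))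
    (hg : g ∈ Submodule.span ℝ (D.diffs p T)) : HasProductLimit P f g := by
  have hgen : ∀ f ∈ D.levels p T, ∀ g ∈ D.levels p T, HasProductLimit P f g := by
    rintro f (⟨s, hs, rfl⟩ | ⟨l, rfl⟩) g (⟨t, ht, rfl⟩ | ⟨m, rfl⟩)
    · exact hlim.lim_yy s hs t ht
    · obtain ⟨t, ht, k, rfl⟩ := hloc m
      exact hlim.lim_yx s hs t ht k
    · obtain ⟨s, hs, k, rfl⟩ := hloc l
      exact HasProductLimit.symm (hlim.lim_yx t ht s hs k)
    · obtain ⟨s, hs, j, rfl⟩ := hloc l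
      obtain ⟨t, ht, k, rfl⟩ := hloc m
      exact hlim.lim_xx s hs t ht j k
  have hsub : ∀ f ∈ D.diffs p T, f = (fun _ _ => 1) ∨ f ∈ Submodule.span ℝ (D.levels p T) := by
    rintro f (rfl | ⟨a, ha, rfl⟩ | ⟨l, rfl⟩)
    · exact Or.inl rfl
    · exact Or.inr (D.dy_mem_span_levels ha)
    · exact Or.inr (Submodule.subset_span (D.x_mem_levels l))
  have hone : ∀ f ∈ D.diffs p T, HasProductLimit P (fun _ _ => 1) f := by
    intro f hf
    obtain ⟨m, hm⟩ := hmean f hf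
    refine ⟨m, ?_⟩
    simp only [one_mul, hm]
    exact tendsto_average tendsto_const_nhds
  refine HasProductLimit.of_mem_span hdiff (fun f hf g hg => ?_) hf hg
  rcases hsub f hf with rfl | hf'
  · exact hone g hg
  · rcases hsub g hg with rfl | hg'
    · exact (hone f hf).symm
    · exact HasProductLimit.of_mem_span hlev hgen hf' hg'

/-- Averages of products of variables of the differenced system obey the strong law. -/
theorem Panel.strong_law_mul [IsProbabilityMeasure P]
    (hy : ∀ i : ℕ, ∀ t ∈ Set.Icc (1 - (p : ℤ)) T, Measurable (D.y i t))
    (hx : ∀ (i : ℕ) (l : Fin q), Measurable (D.x i l))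
    (hindep : iIndepFun (fun i => D.obs p T i) P) {s : ℝ} (hs : 2 < s)
    (hbdd : ∀ f ∈ Submodule.span ℝ (D.diffs p T), BddMoment P s f)
    {f g : ℕ → Ω → ℝ} (hf : f ∈ Submodule.span ℝ (D.diffs p T))
    (hg : g ∈ Submodule.span ℝ (D.diffs p T)) :
    ∀ᵐ ω ∂P, Tendsto (fun N : ℕ => (N : ℝ)⁻¹ * ∑ i ∈ Finset.range N,
      (f i ω * g i ω - ∫ ω', f i ω' * g i ω' ∂P)) atTop (𝓝 0) := by
  have hfm := D.measurable_of_mem_span hy hx hf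
  have hgm := D.measurable_of_mem_span hy hx hg
  obtain ⟨M, hM⟩ := (hbdd f hf).mul (by linarith) (hbdd g hg) hfm hgm
  have hind : iIndepFun (f * g) P := iIndep_of_iIndep_of_le hindep fun i =>
    ((D.measurable_comap_obs hf i).mul (D.measurable_comap_obs hg i)).comap_le
  exact strong_law_of_moment (fun i => (hfm i).mul (hgm i)) hind (r := s / 2) (by linarith)
    (fun i => (hM i).1) fun i => (hM i).2

end Spans

/-! ### The differenced system at the true parameter -/

section System

variable {Ω : Type*} {p T K q : ℕ} (D : Panel Ω K q)

/-- The differenced model in row `a ≥ p` of the system. -/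
theorem Panel.dy_eq {δ : Fin p → ℝ} {β : Fin K → ℝ} (hmodel : D.Model p T δ β) {a : ℕ}
    (hpa : p ≤ a) (ha : a < p + T - 1) (i : ℕ) (ω : Ω) :
    D.dy i (rowTime p a) ω = ∑ j : Fin p, δ j * D.dy i (rowTime p (a - (j + 1))) ω
      + ∑ k, β k * D.dx i (rowTime p a) k ω + D.de i (rowTime p a) ω := by
  have h1 := hmodel i (rowTime p a) (by simp only [rowTime, Set.mem_Icc]; omega) ω
  have h2 := hmodel i (rowTime p a - 1) (by simp only [rowTime, Set.mem_Icc]; omega) ω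
  have h3 : ∀ j : Fin p, D.dy i (rowTime p (a - (j + 1))) ω =
      D.y i (rowTime p a - ((j : ℤ) + 1)) ω - D.y i (rowTime p a - 1 - ((j : ℤ) + 1)) ω := by
    intro j
    rw [← rowTime_sub (by omega), dy, sub_right_comm]
  simp only [h3, dx, de, mul_sub, Finset.sum_sub_distrib]
  rw [dy, h1, h2]
  ring

theorem Panel.wTilde_mulVec_mkParam_of_lt (i : ℕ) (ω : Ω) {δ : Fin p → ℝ} {β : Fin K → ℝ}
    {μ : Fin p → ℝ} {θ : Fin p → Fin q → ℝ} {Υ : Matrix (Fin (p + T - 1)) (Fin (p + T - 1)) ℝ}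
    {a : Fin (p + T - 1)} (ha : (a : ℕ) < p) :
    (D.wTilde p T i ω *ᵥ etaOf (mkParam δ β μ θ Υ)) a =
      μ ⟨a, ha⟩ + (fun l => D.x i l ω) ⬝ᵥ θ ⟨a, ha⟩ := by
  have hm : ∀ m : Fin p, (a : ℕ) = m ↔ (⟨a, ha⟩ : Fin p) = m := fun m => by
    rw [Fin.ext_iff]
  simp only [mulVec, dotProduct, Fintype.sum_sum_type, Fintype.sum_prod_type, wTilde, of_apply,
    ha, if_true, zero_mul, Finset.sum_const_zero, zero_add, etaOf, mkParam, Sum.elim_inl,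
    Sum.elim_inr, Finset.univ_unique, Finset.sum_singleton, hm, ite_mul, one_mul,
    Finset.sum_add_distrib]
  rw [Finset.sum_ite_eq, if_pos (Finset.mem_univ _), Finset.sum_comm]
  simp only [Finset.sum_ite_eq, Finset.mem_univ, if_true]

theorem Panel.wTilde_mulVec_mkParam_of_le (i : ℕ) (ω : Ω) {δ : Fin p → ℝ} {β : Fin K → ℝ}
    {μ : Fin p → ℝ} {θ : Fin p → Fin q → ℝ} {Υ : Matrix (Fin (p + T - 1)) (Fin (p + T - 1)) ℝ}
    {a : Fin (p + T - 1)} (ha : p ≤ (a : ℕ)) :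
    (D.wTilde p T i ω *ᵥ etaOf (mkParam δ β μ θ Υ)) a =
      ∑ j : Fin p, δ j * D.dy i (rowTime p (a - (j + 1))) ω
        + ∑ k, β k * D.dx i (rowTime p a) k ω := by
  have hm : ∀ m : Fin p, (a : ℕ) ≠ m := fun m => by omega
  have hj : ∀ j : Fin p, rowTime p a - ((j : ℤ) + 1) = rowTime p (a - (j + 1)) := fun j =>
    rowTime_sub (by omega)
  simp only [mulVec, dotProduct, Fintype.sum_sum_type, Fintype.sum_prod_type, wTilde, of_apply,
    ha.not_gt, if_false, etaOf, mkParam, Sum.elim_inl, Sum.elim_inr, hm, zero_mul,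
    Finset.sum_const_zero, add_zero, hj]
  simp only [mul_comm]

/-- At the true parameter the residuals are the errors of the differenced system. -/
theorem Panel.resid_mkParam [MeasurableSpace Ω] (P : Measure Ω) {δ : Fin p → ℝ} {β : Fin K → ℝ}
    (hmodel : D.Model p T δ β) {μ : Fin p → ℝ} {θ : Fin p → Fin q → ℝ}
    {Υ : Matrix (Fin (p + T - 1)) (Fin (p + T - 1)) ℝ} {i : ℕ}
    (hμ : ∀ m, μ m = D.projIntercept P i (rowTime p m))
    (hθ : ∀ m, θ m = D.projSlope P i (rowTime p m)) (ω : Ω) :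
    D.resid p T i (etaOf (mkParam δ β μ θ Υ)) ω = D.sysError P p T i ω := by
  ext a
  rw [resid, Pi.sub_apply, yTilde, sysError]
  by_cases ha : (a : ℕ) < p
  · rw [D.wTilde_mulVec_mkParam_of_lt i ω ha, if_pos ha, hμ, hθ]
    ring
  · rw [D.wTilde_mulVec_mkParam_of_le i ω (not_lt.1 ha), if_neg ha,
      D.dy_eq hmodel (not_lt.1 ha) a.2]
    ring

end System

/-! ### Moments of the projection residuals and the errors -/

section Projection

variable {Ω : Type*} [MeasurableSpace Ω] {P : Measure Ω} [IsProbabilityMeasure P] {K q : ℕ}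
  (D : Panel Ω K q)

/-- The residual of the linear projection of `Δy_{it}` on `(1, x_i)` is centered. -/
theorem Panel.integral_projResid {i : ℕ} {t : ℤ} (hx : ∀ l, MemLp (D.x i l) 2 P)
    (hy : MemLp (D.dy i t) 2 P) :
    ∫ ω, (D.dy i t ω - D.projIntercept P i t
      - (fun l => D.x i l ω) ⬝ᵥ D.projSlope P i t) ∂P = 0 := by
  have hxi : ∀ l, Integrable (D.x i l) P := fun l => (hx l).integrable (by norm_num)
  have hyi : Integrable (D.dy i t) P := hy.integrable (by norm_num)
  have h0 : Integrable (fun ω => D.dy i t ω - D.projIntercept P i t) P :=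
    hyi.sub (integrable_const _)
  simp only [dotProduct]
  rw [integral_sub h0 (integrable_finsetSum _ fun l _ => (hxi l).mul_const _),
    integral_sub hyi (integrable_const _), integral_finsetSum _ fun l _ => (hxi l).mul_const _]
  simp only [integral_mul_const, integral_const, probReal_univ, one_smul, projIntercept,
    dotProduct]
  ring

/-- The projection residual is uncorrelated with the regressors. -/
theorem Panel.covariance_projResid {i : ℕ} {t : ℤ} (hx : ∀ l, MemLp (D.x i l) 2 P)
    (hy : MemLp (D.dy i t) 2 P) (hvar : IsUnit (D.varX P i).det) (l : Fin q) :
    cov[D.x i l, fun ω => D.dy i t ω - D.projIntercept P i t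
      - (fun l => D.x i l ω) ⬝ᵥ D.projSlope P i t; P] = 0 := by
  have hs : MemLp (fun ω => ∑ k, D.x i k ω * D.projSlope P i t k) 2 P :=
    memLp_finsetSum _ fun k _ => (hx k).mul_const _
  have h1 : cov[D.x i l, fun ω => ∑ k, D.x i k ω * D.projSlope P i t k; P] =
      cov[D.x i l, D.dy i t; P] := by
    rw [covariance_fun_sum_right (fun k => (hx k).mul_const _) (hx l)]
    simp only [covariance_mul_const_right]
    have h2 : D.varX P i *ᵥ D.projSlope P i t = fun l => cov[D.x i l, D.dy i t; P] := by
      rw [projSlope, mulVec_mulVec, mul_nonsing_inv _ hvar, one_mulVec]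
    exact congrFun h2 l
  have h0 : MemLp (fun ω => D.dy i t ω - D.projIntercept P i t) 2 P := hy.sub (memLp_const _)
  simp only [dotProduct]
  rw [covariance_fun_sub_right (hx l) h0 hs, h1,
    covariance_fun_sub_right (hx l) hy (memLp_const _), covariance_const_right]
  ring

variable {p T : ℕ}

theorem Panel.integral_sysError {i : ℕ} (hx : ∀ l, MemLp (D.x i l) 2 P)
    (hy : ∀ a < p + T - 1, MemLp (D.dy i (rowTime p a)) 2 P)
    (hmean : ∀ t ∈ Set.Icc (2 : ℤ) T, ∫ ω, D.de i t ω ∂P = 0) (a : Fin (p + T - 1)) :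
    ∫ ω, D.sysError P p T i ω a ∂P = 0 := by
  simp only [sysError]
  split_ifs with ha
  · exact D.integral_projResid hx (hy a a.2)
  · exact hmean _ (by simp only [rowTime, Set.mem_Icc]; omega)

theorem Panel.integral_x_mul_sysError {i : ℕ} (hx : ∀ l, MemLp (D.x i l) 2 P)
    (hy : ∀ a < p + T - 1, MemLp (D.dy i (rowTime p a)) 2 P)
    (hu : ∀ a, MemLp (fun ω => D.sysError P p T i ω a) 2 P)
    (hvar : IsUnit (D.varX P i).det)
    (hmean : ∀ t ∈ Set.Icc (2 : ℤ) T, ∫ ω, D.de i t ω ∂P = 0)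
    (hcov : ∀ l, ∀ t ∈ Set.Icc (2 : ℤ) T, cov[D.x i l, D.de i t; P] = 0)
    (l : Fin q) (a : Fin (p + T - 1)) :
    ∫ ω, D.x i l ω * D.sysError P p T i ω a ∂P = 0 := by
  have h1 := covariance_eq_sub (hx l) (hu a)
  rw [D.integral_sysError hx hy hmean, mul_zero, sub_zero] at h1
  refine Eq.trans h1.symm ?_
  simp only [sysError]
  split_ifs with ha
  · exact D.covariance_projResid hx (hy a a.2) hvar l
  · exact hcov l _ (by simp only [rowTime, Set.mem_Icc]; omega)

/-- The means of the `Δy_{it}` are the same for all individuals: those of the initial differences by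
assumption, the others by the recursion of the model. -/
theorem Panel.exists_integral_dy_eq (hproj : D.ProjectionMoments P p T)
    {δ : Fin p → ℝ} {β : Fin K → ℝ} (hmodel : D.Model p T δ β)
    (hx : ∀ i l, MemLp (D.x i l) 2 P)
    (hy : ∀ i, ∀ a < p + T - 1, MemLp (D.dy i (rowTime p a)) 2 P)
    (hde : ∀ i, ∀ t ∈ Set.Icc (2 : ℤ) T, Integrable (D.de i t) P)
    (hmean : ∀ i, ∀ t ∈ Set.Icc (2 : ℤ) T, ∫ ω, D.de i t ω ∂P = 0) (a : ℕ) (ha : a < p + T - 1) :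
    ∃ m, ∀ i, ∫ ω, D.dy i (rowTime p a) ω ∂P = m := by
  obtain ⟨mx, hmx⟩ := hproj.mean_x
  have hxi : ∀ i l, Integrable (D.x i l) P := fun i l => (hx i l).integrable (by norm_num)
  induction a using Nat.strong_induction_on with
  | _ a ih =>
    by_cases hpa : a < p
    · obtain ⟨m, hm⟩ := hproj.mean_dy
      refine ⟨m ⟨p - 1 - a, by omega⟩, fun i => ?_⟩
      have ht : rowTime p a = 2 - (((p - 1 - a : ℕ) : ℤ) + 1) := by
        simp only [rowTime]; omega
      rw [← hm i, ht]
    · push Not at hpa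
      choose! m hm using ih
      refine ⟨∑ j : Fin p, δ j * m (a - (j + 1)) +
        ∑ k, β k * (mx (D.loc (rowTime p a) k) - mx (D.loc (rowTime p a - 1) k)), fun i => ?_⟩
      have ht : rowTime p a ∈ Set.Icc (2 : ℤ) T := by
        simp only [rowTime, Set.mem_Icc]; omega
      have h1 : ∀ j : Fin p, Integrable (D.dy i (rowTime p (a - (j + 1)))) P := fun j =>
        (hy i _ (by omega)).integrable (by norm_num)
      have h2 : ∀ k, Integrable (D.dx i (rowTime p a) k) P := fun k => (hxi i _).sub (hxi i _)
      have h3 : Integrable (fun ω => ∑ j : Fin p, δ j * D.dy i (rowTime p (a - (j + 1))) ω) P :=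
        integrable_finsetSum _ fun j _ => (h1 j).const_mul _
      have h4 : Integrable (fun ω => ∑ k, β k * D.dx i (rowTime p a) k ω) P :=
        integrable_finsetSum _ fun k _ => (h2 k).const_mul _
      have h34 : Integrable (fun ω => ∑ j : Fin p, δ j * D.dy i (rowTime p (a - (j + 1))) ω +
        ∑ k, β k * D.dx i (rowTime p a) k ω) P := h3.add h4
      simp only [D.dy_eq hmodel hpa ha]
      rw [integral_add h34 (hde i _ ht), hmean i _ ht, add_zero, integral_add h3 h4,
        integral_finsetSum _ fun j _ => (h1 j).const_mul _,
        integral_finsetSum _ fun k _ => (h2 k).const_mul _]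
      simp only [integral_const_mul]
      congr 1
      · refine Finset.sum_congr rfl fun j _ => ?_
        rw [hm (a - (j + 1)) (by omega) (by omega) i]
      · refine Finset.sum_congr rfl fun k _ => ?_
        simp only [dx, xt]
        rw [integral_sub (hxi i _) (hxi i _), hmx, hmx]

/-- `E(Δy u')` is `E(u u')` multiplied from the left by a lower triangular matrix, because the
recursion of the model expresses each `Δy` through `(1, x)` and the current and earlier errors. -/
theorem Panel.exists_integral_dy_mul_sysError {i : ℕ} {δ : Fin p → ℝ} {β : Fin K → ℝ}
    (hmodel : D.Model p T δ β) (hx : ∀ l, MemLp (D.x i l) 2 P)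
    (hy : ∀ a < p + T - 1, MemLp (D.dy i (rowTime p a)) 2 P)
    (hu : ∀ a, MemLp (fun ω => D.sysError P p T i ω a) 2 P)
    (hu0 : ∀ a, ∫ ω, D.sysError P p T i ω a ∂P = 0)
    (hxu : ∀ l a, ∫ ω, D.x i l ω * D.sysError P p T i ω a ∂P = 0)
    {Υ : Matrix (Fin (p + T - 1)) (Fin (p + T - 1)) ℝ}
    (herr : ∀ a b, ∫ ω, D.sysError P p T i ω a * D.sysError P p T i ω b ∂P = Υ a b)
    (a : ℕ) (ha : a < p + T - 1) :
    ∃ g : Fin (p + T - 1) → ℝ, (∀ b : Fin (p + T - 1), a < (b : ℕ) → g b = 0) ∧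
      ∀ c, ∫ ω, D.dy i (rowTime p a) ω * D.sysError P p T i ω c ∂P = ∑ b, g b * Υ b c := by
  have hxu' : ∀ l c, Integrable (fun ω => D.x i l ω * D.sysError P p T i ω c) P := fun l c =>
    (hx l).integrable_mul (hu c)
  have huu : ∀ b c, Integrable (fun ω => D.sysError P p T i ω b * D.sysError P p T i ω c) P :=
    fun b c => (hu b).integrable_mul (hu c)
  have hui : ∀ c, Integrable (fun ω => D.sysError P p T i ω c) P := fun c =>
    (hu c).integrable (by norm_num)
  induction a using Nat.strong_induction_on with
  | _ a ih =>
    by_cases hpa : a < p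
    · refine ⟨Pi.single ⟨a, ha⟩ 1, fun b hb => ?_, fun c => ?_⟩
      · exact Pi.single_eq_of_ne (fun h => by rw [h] at hb; exact lt_irrefl _ hb) _
      have h1 : ∀ ω, D.dy i (rowTime p a) ω * D.sysError P p T i ω c =
          D.sysError P p T i ω ⟨a, ha⟩ * D.sysError P p T i ω c
            + (D.projIntercept P i (rowTime p a) * D.sysError P p T i ω c
            + ∑ l, D.projSlope P i (rowTime p a) l * (D.x i l ω * D.sysError P p T i ω c)) := by
        intro ω
        have h2 : D.dy i (rowTime p a) ω = D.sysError P p T i ω ⟨a, ha⟩ +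
            (D.projIntercept P i (rowTime p a) +
              ∑ l, D.projSlope P i (rowTime p a) l * D.x i l ω) := by
          simp only [sysError, hpa, if_true, dotProduct, mul_comm (D.projSlope P i _ _)]
          ring
        rw [h2, add_mul, add_mul, Finset.sum_mul]
        simp only [mul_assoc]
      have h3 : Integrable (fun ω => D.projIntercept P i (rowTime p a) *
          D.sysError P p T i ω c) P := (hui c).const_mul _
      have h4 : Integrable (fun ω => ∑ l, D.projSlope P i (rowTime p a) l *
          (D.x i l ω * D.sysError P p T i ω c)) P :=
        integrable_finsetSum _ fun l _ => (hxu' l c).const_mul _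
      have h34 : Integrable (fun ω => D.projIntercept P i (rowTime p a) * D.sysError P p T i ω c +
          ∑ l, D.projSlope P i (rowTime p a) l * (D.x i l ω * D.sysError P p T i ω c)) P :=
        h3.add h4
      simp only [h1]
      rw [integral_add (huu _ _) h34, integral_add h3 h4,
        integral_finsetSum _ fun l _ => (hxu' l c).const_mul _]
      simp only [integral_const_mul, hu0, hxu, mul_zero, Finset.sum_const_zero, add_zero, herr,
        Pi.single_apply, ite_mul, one_mul, zero_mul, Finset.sum_ite_eq', Finset.mem_univ, if_true]
    · push Not at hpa
      choose! g hg0 hg using ih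
      refine ⟨fun b => (∑ j : Fin p, δ j * g (a - (j + 1)) b) + if b = ⟨a, ha⟩ then 1 else 0,
        fun b hb => ?_, fun c => ?_⟩
      · have h1 : b ≠ ⟨a, ha⟩ := fun h => by rw [h] at hb; exact lt_irrefl _ hb
        simp only [h1, if_false, add_zero]
        refine Finset.sum_eq_zero fun j _ => ?_
        rw [hg0 (a - (j + 1)) (by omega) (by omega) b (by omega), mul_zero]
      have h1 : ∀ ω, D.dy i (rowTime p a) ω * D.sysError P p T i ω c =
          ((∑ j : Fin p, δ j * (D.dy i (rowTime p (a - (j + 1))) ω * D.sysError P p T i ω c))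
            + ∑ k, β k * (D.x i (D.loc (rowTime p a) k) ω * D.sysError P p T i ω c
              - D.x i (D.loc (rowTime p a - 1) k) ω * D.sysError P p T i ω c))
            + D.sysError P p T i ω ⟨a, ha⟩ * D.sysError P p T i ω c := by
        intro ω
        have h2 : D.sysError P p T i ω ⟨a, ha⟩ = D.de i (rowTime p a) ω := by
          simp only [sysError, hpa.not_gt, if_false]
        rw [D.dy_eq hmodel hpa ha, h2, add_mul, add_mul, Finset.sum_mul, Finset.sum_mul]
        simp only [dx, xt, mul_assoc, sub_mul]
      have hdu : ∀ j : Fin p, Integrable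
          (fun ω => D.dy i (rowTime p (a - (j + 1))) ω * D.sysError P p T i ω c) P := fun j =>
        (hy _ (by omega)).integrable_mul (hu c)
      have hxd : ∀ k, Integrable (fun ω => D.x i (D.loc (rowTime p a) k) ω *
          D.sysError P p T i ω c - D.x i (D.loc (rowTime p a - 1) k) ω *
          D.sysError P p T i ω c) P := fun k => (hxu' _ c).sub (hxu' _ c)
      have h3 : Integrable (fun ω => ∑ j : Fin p, δ j *
          (D.dy i (rowTime p (a - (j + 1))) ω * D.sysError P p T i ω c)) P :=
        integrable_finsetSum _ fun j _ => (hdu j).const_mul _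
      have h4 : Integrable (fun ω => ∑ k, β k * (D.x i (D.loc (rowTime p a) k) ω *
          D.sysError P p T i ω c - D.x i (D.loc (rowTime p a - 1) k) ω *
          D.sysError P p T i ω c)) P :=
        integrable_finsetSum _ fun k _ => (hxd k).const_mul _
      have h34 : Integrable (fun ω => (∑ j : Fin p, δ j *
          (D.dy i (rowTime p (a - (j + 1))) ω * D.sysError P p T i ω c)) +
          ∑ k, β k * (D.x i (D.loc (rowTime p a) k) ω * D.sysError P p T i ω c -
            D.x i (D.loc (rowTime p a - 1) k) ω * D.sysError P p T i ω c)) P := h3.add h4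
      simp only [h1]
      rw [integral_add h34 (huu _ _), integral_add h3 h4,
        integral_finsetSum _ fun j _ => (hdu j).const_mul _,
        integral_finsetSum _ fun k _ => (hxd k).const_mul _]
      have h5 : ∀ k, ∫ ω, (D.x i (D.loc (rowTime p a) k) ω *
          D.sysError P p T i ω c - D.x i (D.loc (rowTime p a - 1) k) ω *
          D.sysError P p T i ω c) ∂P = 0 := fun k => by
        rw [integral_sub (hxu' _ c) (hxu' _ c), hxu, hxu, sub_zero]
      simp only [integral_const_mul, h5, mul_zero, Finset.sum_const_zero, add_zero, herr, add_mul,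
        Finset.sum_add_distrib, ite_mul, one_mul, zero_mul, Finset.sum_ite_eq', Finset.mem_univ,
        if_true, Finset.sum_mul]
      rw [Finset.sum_comm]
      congr 1
      refine Finset.sum_congr rfl fun j _ => ?_
      rw [hg (a - (j + 1)) (by omega) (by omega) c, Finset.mul_sum]
      simp only [mul_assoc]

/-- Orthogonality behind the expected score in `η`: for every column `w` of the regressor matrix,
the matrix `Υ⁻¹ E(u w')` has zero diagonal. -/
theorem Panel.sum_inv_mul_integral_augReg {i : ℕ} {δ : Fin p → ℝ} {β : Fin K → ℝ}
    (hmodel : D.Model p T δ β) (hx : ∀ l, MemLp (D.x i l) 2 P)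
    (hy : ∀ a < p + T - 1, MemLp (D.dy i (rowTime p a)) 2 P)
    (hu : ∀ a, MemLp (fun ω => D.sysError P p T i ω a) 2 P)
    (hu0 : ∀ a, ∫ ω, D.sysError P p T i ω a ∂P = 0)
    (hxu : ∀ l a, ∫ ω, D.x i l ω * D.sysError P p T i ω a ∂P = 0)
    {Υ : Matrix (Fin (p + T - 1)) (Fin (p + T - 1)) ℝ} (hΥ : Υ.PosDef)
    (herr : ∀ a b, ∫ ω, D.sysError P p T i ω a * D.sysError P p T i ω b ∂P = Υ a b)
    (a : Fin (p + T - 1)) (c : EtaIdx p K q) :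
    ∑ b, Υ⁻¹ a b * ∫ ω, D.augReg p T a (some c) i ω * D.sysError P p T i ω b ∂P = 0 := by
  have hzero : (∀ b, ∫ ω, D.wTilde p T i ω a c * D.sysError P p T i ω b ∂P = 0) →
      ∑ b, Υ⁻¹ a b * ∫ ω, D.augReg p T a (some c) i ω * D.sysError P p T i ω b ∂P = 0 := by
    intro h
    refine Finset.sum_eq_zero fun b _ => ?_
    simp only [augReg, neg_mul, integral_neg, h b, neg_zero, mul_zero]
  have hxu' : ∀ l c, Integrable (fun ω => D.x i l ω * D.sysError P p T i ω c) P := fun l c =>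
    (hx l).integrable_mul (hu c)
  rcases c with j | k | ⟨m, v | l⟩
  · by_cases hpa : (a : ℕ) < p
    · exact hzero fun b => by simp [wTilde, hpa]
    · push Not at hpa
      obtain ⟨g, hg0, hg⟩ := D.exists_integral_dy_mul_sysError hmodel hx hy hu hu0 hxu herr
        (a - (j + 1)) (by omega)
      simp only [augReg, wTilde, of_apply, hpa.not_gt, if_false, neg_mul, integral_neg,
        rowTime_sub (show (j : ℕ) + 1 ≤ a by omega), hg]
      -- `Υ` cancels against `Υ⁻¹`, which leaves an entry above the diagonal
      have hdet : IsUnit Υ.det := isUnit_iff_ne_zero.2 (ne_of_gt hΥ.det_pos)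
      have h1 : ∀ d, ∑ b, Υ⁻¹ a b * Υ d b = if a = d then 1 else 0 := fun d => by
        have h2 := congrFun (congrFun (nonsing_inv_mul Υ hdet) a) d
        rw [mul_apply, one_apply] at h2
        rw [← h2]
        refine Finset.sum_congr rfl fun b _ => ?_
        rw [← hΥ.isHermitian.apply d b, star_trivial]
      calc ∑ b, Υ⁻¹ a b * -∑ d, g d * Υ d b = -∑ d, g d * ∑ b, Υ⁻¹ a b * Υ d b := by
            simp only [mul_neg, Finset.sum_neg_distrib, Finset.mul_sum]
            rw [Finset.sum_comm]
            congr 1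
            refine Finset.sum_congr rfl fun d _ => Finset.sum_congr rfl fun b _ => ?_
            ring
        _ = -g a := by simp [h1]
        _ = 0 := by rw [hg0 a (by omega), neg_zero]
  · refine hzero fun b => ?_
    by_cases hpa : (a : ℕ) < p
    · simp [wTilde, hpa]
    · simp only [wTilde, hpa, of_apply, if_false, dx, xt, sub_mul]
      rw [integral_sub (hxu' _ _) (hxu' _ _), hxu, hxu, sub_zero]
  · refine hzero fun b => ?_
    by_cases h : (a : ℕ) = m
    · simpa [wTilde, h] using hu0 b
    · simp [wTilde, h]
  · refine hzero fun b => ?_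
    by_cases h : (a : ℕ) = m
    · simpa [wTilde, h] using hxu l b
    · simp [wTilde, h]

end Projection

/-! ### The expected score -/

section Score

variable {Ω : Type*} {p T K q : ℕ}

theorem upsOf_single_inl (c : EtaIdx p K q) :
    upsOf (EuclideanSpace.single (Sum.inl c) 1 : Param p T K q) = 0 := by
  ext a b
  obtain ⟨ab, h⟩ := exists_upsOf_apply (K := K) (q := q) a b
  simp [h]

theorem etaOf_single_inr (ab : VechIdx (p + T - 1)) :
    etaOf (EuclideanSpace.single (Sum.inr ab) 1 : Param p T K q) = 0 := by
  ext c
  simp [etaOf]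

theorem augCoef_add_smul_single_inr (lam : Param p T K q) (ab : VechIdx (p + T - 1)) (t : ℝ) :
    augCoef (lam + t • (EuclideanSpace.single (Sum.inr ab) 1 : Param p T K q)) = augCoef lam := by
  funext c
  cases c with
  | none => rfl
  | some c => simp [augCoef, etaOf_add_smul, etaOf_single_inr]

theorem augCoef_add_smul_single_inl (lam : Param p T K q) (c : EtaIdx p K q) (t : ℝ)
    (d : Option (EtaIdx p K q)) :
    augCoef (lam + t • (EuclideanSpace.single (Sum.inl c) 1 : Param p T K q)) d =
      augCoef lam d + t * if d = some c then 1 else 0 := by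
  cases d with
  | none => simp [augCoef]
  | some d => simp [augCoef, etaOf]

/-- The first-order conditions for a linear combination `∑ z_j φ_j` of the coefficient functions of
the likelihood. With `z` the expected cross products, `hquad` says that the second moments of the
residuals form `Υ`, and `horth` that the score in `η` is centered. -/
theorem fderiv_sum_quadCoef_eq_zero {z : QuadIdx p T K q → ℝ} {lam : Param p T K q}
    (h : lam ∈ ParamSpace p T K q) (hone : z none = 1)
    (hsymm : ∀ a b c d, z (some ((a, b), (c, d))) = z (some ((b, a), (d, c))))
    (hquad : ∀ a b, ∑ c, ∑ d, augCoef lam c * augCoef lam d * z (some ((a, b), (c, d))) =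
      upsOf lam a b)
    (horth : ∀ a c, ∑ b, (upsOf lam)⁻¹ a b *
      ∑ d, augCoef lam d * z (some ((a, b), (some c, d))) = 0) :
    fderiv ℝ (fun lam => ∑ j, z j * quadCoef j lam) lam = 0 := by
  have hdet : (upsOf lam).det ≠ 0 := ne_of_gt (PosDef.det_pos h)
  have hdiff : DifferentiableAt ℝ (fun lam => ∑ j, z j * quadCoef j lam) lam :=
    (contDiffAt_sum_quadCoef z h).differentiableAt (by norm_num)
  have hline : ∀ v : Param p T K q,
      HasDerivAt (fun t : ℝ => ∑ j, z j * quadCoef j (lam + t • v))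
        (fderiv ℝ (fun lam => ∑ j, z j * quadCoef j lam) lam v) 0 := by
    intro v
    have h1 : HasDerivAt (fun t : ℝ => lam + t • v) v 0 := by
      simpa using ((hasDerivAt_id (0 : ℝ)).smul_const v).const_add lam
    have h2 : HasFDerivAt (fun lam => ∑ j, z j * quadCoef j lam)
        (fderiv ℝ (fun lam => ∑ j, z j * quadCoef j lam) lam) (lam + (0 : ℝ) • v) := by
      simpa using hdiff.hasFDerivAt
    exact h2.comp_hasDerivAt 0 h1
  have hsingle : ∀ k, fderiv ℝ (fun lam => ∑ j, z j * quadCoef j lam) lam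
      (EuclideanSpace.single k 1) = 0 := by
    intro k
    refine (hline _).unique ?_
    simp only [sum_quadCoef, hone, one_mul]
    simp only [quadCoef]
    rcases k with c | ab
    · -- in the direction of `η` only the quadratic form varies
      simp only [upsOf_add_smul, upsOf_single_inl, smul_zero, add_zero,
        augCoef_add_smul_single_inl]
      have h1 : ∀ d, HasDerivAt (fun t : ℝ => augCoef lam d + t * if d = some c then 1 else 0)
          (if d = some c then 1 else 0) 0 := fun d => by
        simpa using ((hasDerivAt_id (0 : ℝ)).mul_const
          (if d = some c then (1 : ℝ) else 0)).const_add (augCoef lam d)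
      have h2 := (HasDerivAt.fun_sum (u := Finset.univ) fun a _ =>
        HasDerivAt.fun_sum (u := Finset.univ) fun b _ =>
          (HasDerivAt.fun_sum (u := Finset.univ) fun d _ =>
            HasDerivAt.fun_sum (u := Finset.univ) fun d' _ =>
              ((h1 d).fun_mul (h1 d')).mul_const (z (some ((a, b), (d, d'))))).const_mul
            ((upsOf lam)⁻¹ a b)).const_mul (1 / 2 : ℝ)
      have h3 := h2.const_sub (-(((T : ℝ) + p - 1) / 2) * Real.log (2 * Real.pi)
        - 1 / 2 * Real.log (upsOf lam).det)
      refine h3.congr_deriv ?_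
      simp only [zero_mul, add_zero, add_mul, Finset.sum_add_distrib, ite_mul, one_mul, mul_ite,
        mul_one, mul_zero, Finset.sum_ite_eq', Finset.mem_univ, if_true, mul_add]
      have hinv : (upsOf lam)⁻¹.IsHermitian := (upsOf_isHermitian lam).inv
      have h4 : ∑ a, ∑ b, (upsOf lam)⁻¹ a b *
          ∑ d, augCoef lam d * z (some ((a, b), (some c, d))) = 0 :=
        Finset.sum_eq_zero fun a _ => horth a c
      have h5 : ∑ a, ∑ b, (upsOf lam)⁻¹ a b *
          ∑ d, augCoef lam d * z (some ((a, b), (d, some c))) = 0 := by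
        rw [← h4, Finset.sum_comm]
        refine Finset.sum_congr rfl fun b _ => Finset.sum_congr rfl fun a _ => ?_
        rw [← hinv.apply b a, star_trivial]
        simp only [hsymm a b]
      have h6 : ∀ a b, ∑ d, ∑ d', (if d = some c then
          augCoef lam d' * z (some ((a, b), (d, d'))) else 0) =
          ∑ d, augCoef lam d * z (some ((a, b), (some c, d))) := by
        intro a b
        rw [Finset.sum_comm]
        simp
      simp only [h6]
      rw [h4, h5]
      simp
    · -- in the direction of `Υ` the expected likelihood is `ln |Υ| + tr (Υ⁻¹ Υ₀)` up to constants
      simp only [augCoef_add_smul_single_inr, hquad, upsOf_add_smul]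
      set V := upsOf (EuclideanSpace.single (Sum.inr ab) 1 : Param p T K q)
      have h1 := ((hasDerivAt_log_det_add_trace hdet V).const_mul (1 / 2 : ℝ)).const_sub
        (-(((T : ℝ) + p - 1) / 2) * Real.log (2 * Real.pi))
      rw [mul_zero, neg_zero] at h1
      refine h1.congr_of_eventuallyEq (Eventually.of_forall fun t => ?_)
      have h2 : ((upsOf lam + t • V)⁻¹ * upsOf lam).trace =
          ∑ a, ∑ b, (upsOf lam + t • V)⁻¹ a b * upsOf lam a b := by
        simp only [trace, diag_apply, mul_apply]
        refine Finset.sum_congr rfl fun a _ => Finset.sum_congr rfl fun b _ => ?_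
        rw [← (upsOf_isHermitian lam).apply b a, star_trivial]
      simp only [h2]
      ring
  ext v
  have hsum : v = ∑ a, v a • EuclideanSpace.single a (1 : ℝ) := by
    simpa using ((EuclideanSpace.basisFun (ParamIdx p T K q) ℝ).sum_repr v).symm
  rw [hsum]
  simp only [map_sum, map_smul, hsingle, smul_zero, Finset.sum_const_zero, _root_.zero_apply]

/-- Each cross product is a product of two variables of the system; the constant is `1 * 1`. -/
theorem Panel.exists_cross_eq_mul (D : Panel Ω K q) (j : QuadIdx p T K q) :
    ∃ f ∈ Submodule.span ℝ (D.diffs p T), ∃ g ∈ Submodule.span ℝ (D.diffs p T),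
      D.cross j = fun i ω => f i ω * g i ω := by
  cases j with
  | none =>
    refine ⟨_, Submodule.subset_span D.one_mem_diffs, _, Submodule.subset_span D.one_mem_diffs, ?_⟩
    simp [cross]
  | some j => exact ⟨_, D.augReg_mem_span _ _, _, D.augReg_mem_span _ _, rfl⟩

/-- The expected score of each individual vanishes at the true parameter. -/
theorem Panel.fderiv_expected_eq_zero [MeasurableSpace Ω] {P : Measure Ω}
    [IsProbabilityMeasure P] (D : Panel Ω K q) {i : ℕ}
    {δ : Fin p → ℝ} {β : Fin K → ℝ} (hmodel : D.Model p T δ β)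
    (hL2 : ∀ f ∈ Submodule.span ℝ (D.diffs p T), MemLp (f i) 2 P)
    (hvar : IsUnit (D.varX P i).det)
    (hmean : ∀ t ∈ Set.Icc (2 : ℤ) T, ∫ ω, D.de i t ω ∂P = 0)
    (hcov : ∀ l, ∀ t ∈ Set.Icc (2 : ℤ) T, cov[D.x i l, D.de i t; P] = 0)
    {Υ : Matrix (Fin (p + T - 1)) (Fin (p + T - 1)) ℝ} (hΥ : Υ.PosDef)
    (herr : ∀ a b, ∫ ω, D.sysError P p T i ω a * D.sysError P p T i ω b ∂P = Υ a b)
    {lam : Param p T K q} (hups : upsOf lam = Υ)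
    (hres : ∀ ω, D.resid p T i (etaOf lam) ω = D.sysError P p T i ω) :
    fderiv ℝ (fun lam : Param p T K q => ∑ j, (∫ ω, D.cross j i ω ∂P) * quadCoef j lam) lam =
      0 := by
  have hreg : ∀ a c, MemLp (D.augReg p T a c i) 2 P := fun a c => hL2 _ (D.augReg_mem_span a c)
  have hx : ∀ l, MemLp (D.x i l) 2 P := fun l => hL2 _ (Submodule.subset_span (D.x_mem_diffs l))
  have hy : ∀ a < p + T - 1, MemLp (D.dy i (rowTime p a)) 2 P := fun a ha =>
    hL2 _ (Submodule.subset_span (D.dy_mem_diffs ha))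
  have herror : ∀ a ω, D.sysError P p T i ω a =
      ∑ c, augCoef lam c * D.augReg p T a c i ω := fun a ω => by
    rw [← hres, resid_apply]
  have hu : ∀ a, MemLp (fun ω => D.sysError P p T i ω a) 2 P := fun a => by
    simp only [herror]
    exact memLp_finsetSum _ fun c _ => (hreg a c).const_mul _
  have hu0 := D.integral_sysError (P := P) (i := i) hx hy hmean
  have hxu := D.integral_x_mul_sysError (P := P) (i := i) hx hy hu hvar hmean hcov
  refine fderiv_sum_quadCoef_eq_zero ?_ ?_ ?_ ?_ ?_
  · exact show (upsOf lam).PosDef from hups ▸ hΥ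
  · simp [cross]
  · intro a b c d
    simp only [cross]
    congr 1
    funext ω
    ring
  · intro a b
    rw [hups, ← herr]
    simp only [herror, Finset.sum_mul_sum, cross]
    have hterm : ∀ c d, Integrable (fun ω => augCoef lam c * D.augReg p T a c i ω *
        (augCoef lam d * D.augReg p T b d i ω)) P := fun c d =>
      ((hreg a c).const_mul _).integrable_mul ((hreg b d).const_mul _)
    rw [integral_finsetSum _ fun c _ => integrable_finsetSum _ fun d _ => hterm c d]
    refine Finset.sum_congr rfl fun c _ => ?_
    rw [integral_finsetSum _ fun d _ => hterm c d]
    refine Finset.sum_congr rfl fun d _ => ?_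
    rw [← integral_const_mul]
    congr 1
    funext ω
    ring
  · intro a c
    rw [hups, ← D.sum_inv_mul_integral_augReg hmodel hx hy hu hu0 hxu hΥ herr a c]
    refine Finset.sum_congr rfl fun b _ => ?_
    congr 1
    simp only [herror, Finset.mul_sum, cross]
    have hterm : ∀ d, Integrable (fun ω => D.augReg p T a (some c) i ω *
        (augCoef lam d * D.augReg p T b d i ω)) P := fun d =>
      (hreg a (some c)).integrable_mul ((hreg b d).const_mul _)
    rw [integral_finsetSum _ fun d _ => hterm d]
    refine Finset.sum_congr rfl fun d _ => ?_
    rw [← integral_const_mul]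
    congr 1
    funext ω
    ring

end Score

end DiffQML

/-! ### Score, limiting Hessian and consistency -/

open DiffQML in
theorem theorem3 {Ω : Type*} [MeasurableSpace Ω] (P : Measure Ω) [IsProbabilityMeasure P]
    (p T K q : ℕ) (hp : 1 ≤ p) (hT : 2 ≤ T) (D : DiffQML.Panel Ω K q)
    -- every entry of `x_i` is one of the regressors `x_{itk}`
    (hloc : ∀ l : Fin q, ∃ t ∈ Set.Icc (1 : ℤ) T, ∃ k : Fin K, D.loc t k = l)
    (hy : ∀ i : ℕ, ∀ t ∈ Set.Icc (1 - (p : ℤ)) T, Measurable (D.y i t))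
    (hx : ∀ (i : ℕ) (l : Fin q), Measurable (D.x i l))
    (δ₀ : Fin p → ℝ) (β₀ : Fin K → ℝ) (hmodel : D.Model p T δ₀ β₀)
    (hmoment : D.MomentBound P p T)
    (hproj : D.ProjectionMoments P p T)
    -- the differenced errors have mean zero
    (hmean : ∀ i : ℕ, ∀ t ∈ Set.Icc (2 : ℤ) T, ∫ ω, D.de i t ω ∂P = 0)
    (Υ₀ : Matrix (Fin (p + T - 1)) (Fin (p + T - 1)) ℝ) (hΥ₀ : Υ₀.PosDef)
    (herr : ∀ i a b, ∫ ω, D.sysError P p T i ω a * D.sysError P p T i ω b ∂P = Υ₀ a b)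
    (hlim : D.MomentLimits P p T)
    (hindep : iIndepFun (fun i => D.obs p T i) P)
    -- the linear projection parameters, which do not depend on `i`
    (μ₀ : Fin p → ℝ) (hμ₀ : ∀ i m, μ₀ m = D.projIntercept P i (DiffQML.rowTime p m))
    (θ₀ : Fin p → Fin q → ℝ) (hθ₀ : ∀ i m, θ₀ m = D.projSlope P i (DiffQML.rowTime p m))
    (lam₀ : DiffQML.Param p T K q) (hlam₀ : lam₀ = DiffQML.mkParam δ₀ β₀ μ₀ θ₀ Υ₀) :
    -- the derivatives below exist
    (∀ N ω, ∀ lam ∈ DiffQML.ParamSpace p T K q, ContDiffAt ℝ 2 (D.avgQll p T N ω) lam) ∧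
    -- the expected score vanishes at the true parameter
    (∀ N, Integrable (fun ω => gradient (D.avgQll p T N ω) lam₀) P ∧
      ∫ ω, gradient (D.avgQll p T N ω) lam₀ ∂P = 0) ∧
    -- the limiting Hessian exists
    ∃ H : DiffQML.Param p T K q →
        Matrix (DiffQML.ParamIdx p T K q) (DiffQML.ParamIdx p T K q) ℝ,
      (∀ lam ∈ DiffQML.ParamSpace p T K q,
        (∀ a b, (∀ N, Integrable (fun ω => D.avgHessian p T N ω lam a b) P) ∧
          Tendsto (fun N => ∫ ω, D.avgHessian p T N ω lam a b ∂P) atTop (𝓝 (H lam a b))) ∧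
        ∀ᵐ ω ∂P, Tendsto (fun N => D.avgHessian p T N ω lam) atTop (𝓝 (H lam))) ∧
      -- consistency
      ((-(H lam₀)).PosDef →
        ∃ C ⊆ DiffQML.ParamSpace p T K q, IsCompact C ∧ lam₀ ∈ interior C ∧
          ∃ lamHat : ℕ → Ω → DiffQML.Param p T K q,
            (∀ N, Measurable (lamHat N)) ∧
            (∀ N ω, lamHat N ω ∈ C ∧ IsMaxOn (D.avgQll p T N ω) C (lamHat N ω)) ∧
            ∀ᵐ ω ∂P, Tendsto (fun N => lamHat N ω) atTop (𝓝 lam₀)) := by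

  obtain ⟨s, hs, hlevb, hdiffb⟩ := D.exists_bddMoment hmoment hloc hy hx
  have hfm : ∀ f ∈ Submodule.span ℝ (D.diffs p T), ∀ i, Measurable (f i) := fun f hf =>
    D.measurable_of_mem_span hy hx hf
  have hdiffL2 : ∀ f ∈ Submodule.span ℝ (D.diffs p T), ∀ i, MemLp (f i) 2 P := fun f hf =>
    (hdiffb f hf).memLp hs.le (hfm f hf)
  have hlevL2 : ∀ f ∈ Submodule.span ℝ (D.levels p T), ∀ i, MemLp (f i) 2 P := fun f hf =>
    (hlevb f hf).1.memLp hs.le (hlevb f hf).2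
  have hxL2 : ∀ i l, MemLp (D.x i l) 2 P := fun i l =>
    hdiffL2 _ (Submodule.subset_span (D.x_mem_diffs l)) i
  have hdyL2 : ∀ i, ∀ a < p + T - 1, MemLp (D.dy i (rowTime p a)) 2 P := fun i a ha =>
    hdiffL2 _ (Submodule.subset_span (D.dy_mem_diffs ha)) i
  have hups : upsOf lam₀ = Υ₀ := by rw [hlam₀, upsOf_mkParam hΥ₀.isHermitian]
  have hmem : lam₀ ∈ ParamSpace p T K q := show (upsOf lam₀).PosDef from hups ▸ hΥ₀
  have hres : ∀ i ω, D.resid p T i (etaOf lam₀) ω = D.sysError P p T i ω := fun i ω => by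
    rw [hlam₀]
    exact D.resid_mkParam P hmodel (hμ₀ i) (hθ₀ i) ω
  have hvar : ∀ i, IsUnit (D.varX P i).det := fun i => by
    obtain ⟨Ξ, hΞ, h⟩ := hproj.var_x
    rw [h i]
    exact isUnit_iff_ne_zero.2 (ne_of_gt hΞ.det_pos)
  have hde : ∀ i, ∀ t ∈ Set.Icc (2 : ℤ) T, Integrable (D.de i t) P := by
    intro i t ht
    obtain ⟨a, ha, hpa, rfl⟩ : ∃ a < p + T - 1, p ≤ a ∧ rowTime p a = t := by
      obtain ⟨h1, h2⟩ := ht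
      refine ⟨(t + p - 2).toNat, by omega, by omega, ?_⟩
      simp only [rowTime]
      omega
    have h1 : D.de i (rowTime p a) = fun ω => ∑ c, augCoef lam₀ c * D.augReg p T ⟨a, ha⟩ c i ω := by
      funext ω
      rw [← D.resid_apply, hres, Panel.sysError, if_neg (by simpa using hpa)]
    rw [h1]
    exact integrable_finsetSum _ fun c _ =>
      ((hdiffL2 _ (D.augReg_mem_span _ c) i).integrable (by norm_num)).const_mul _
  have hmeans : ∀ f ∈ D.diffs p T, ∃ m, ∀ i, ∫ ω, f i ω ∂P = m := by
    rintro f (rfl | ⟨a, ha, rfl⟩ | ⟨l, rfl⟩)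
    · exact ⟨1, fun i => by simp⟩
    · exact D.exists_integral_dy_eq hproj hmodel hxL2 hdyL2 hde hmean a ha
    · obtain ⟨m, hm⟩ := hproj.mean_x
      exact ⟨m l, fun i => hm i l⟩
  -- the cross products: measurability, integrability and limits of their averages
  have hcm : ∀ (j : QuadIdx p T K q) i, Measurable (D.cross j i) := fun j i => by
    obtain ⟨f, hf, g, hg, h⟩ := D.exists_cross_eq_mul j
    rw [h]
    exact (hfm f hf i).mul (hfm g hg i)
  have hci : ∀ (j : QuadIdx p T K q) i, Integrable (D.cross j i) P := fun j i => by
    obtain ⟨f, hf, g, hg, h⟩ := D.exists_cross_eq_mul j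
    rw [h]
    exact (hdiffL2 f hf i).integrable_mul (hdiffL2 g hg i)
  have hcl : ∀ j : QuadIdx p T K q, ∃ c : ℝ, Tendsto
      (fun N : ℕ => (N : ℝ)⁻¹ * ∑ i ∈ Finset.range N, ∫ ω, D.cross j i ω ∂P) atTop (𝓝 c) :=
    fun j => by
    obtain ⟨f, hf, g, hg, h⟩ := D.exists_cross_eq_mul j
    rw [h]
    exact D.hasProductLimit hlim hloc hlevL2 hdiffL2 hmeans hf hg
  have hcs : ∀ j : QuadIdx p T K q, ∀ᵐ ω ∂P, Tendsto (fun N : ℕ => (N : ℝ)⁻¹ *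
      ∑ i ∈ Finset.range N, (D.cross j i ω - ∫ ω', D.cross j i ω' ∂P)) atTop (𝓝 0) := fun j => by
    obtain ⟨f, hf, g, hg, h⟩ := D.exists_cross_eq_mul j
    rw [h]
    exact D.strong_law_mul hy hx hindep hs hdiffb hf hg
  choose m hm using hcl
  have ham : ∀ N (j : QuadIdx p T K q), Measurable fun ω => D.avgCross N ω j := fun N j =>
    (Finset.measurable_fun_sum _ fun i _ => hcm j i).const_mul _
  have hai : ∀ N (j : QuadIdx p T K q), Integrable (fun ω => D.avgCross N ω j) P := fun N j =>
    (integrable_finsetSum _ fun i _ => hci j i).const_mul _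
  have hae : ∀ N (j : QuadIdx p T K q), ∫ ω, D.avgCross N ω j ∂P =
      (N : ℝ)⁻¹ * ∑ i ∈ Finset.range N, ∫ ω, D.cross j i ω ∂P := fun N j => by
    simp only [Panel.avgCross]
    rw [integral_const_mul, integral_finsetSum _ fun i _ => hci j i]
  have hconv : ∀ᵐ ω ∂P, ∀ j : QuadIdx p T K q,
      Tendsto (fun N => D.avgCross N ω j) atTop (𝓝 (m j)) := by
    rw [ae_all_iff]
    intro j
    filter_upwards [hcs j] with ω hω
    have h1 := hω.add (hm j)
    rw [zero_add] at h1
    refine h1.congr fun N => ?_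
    rw [← mul_add, ← Finset.sum_add_distrib]
    simp only [sub_add_cancel, Panel.avgCross]
  -- the expected score
  have hscore : ∀ i, ∑ j : QuadIdx p T K q,
      (∫ ω, D.cross j i ω ∂P) • fderiv ℝ (quadCoef j) lam₀ = 0 := fun i => by
    rw [← fderiv_sum_quadCoef _ hmem]
    exact D.fderiv_expected_eq_zero hmodel (fun f hf => hdiffL2 f hf i) (hvar i) (hmean i)
      (hproj.cov_x_de i) hΥ₀ (herr i) hups (hres i)
  have hscoreN : ∀ N : ℕ, ∑ j : QuadIdx p T K q,
      ((N : ℝ)⁻¹ * ∑ i ∈ Finset.range N, ∫ ω, D.cross j i ω ∂P) •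
        fderiv ℝ (quadCoef j) lam₀ = 0 := fun N => by
    simp only [mul_smul, Finset.sum_smul, ← Finset.smul_sum]
    rw [Finset.sum_comm, Finset.sum_eq_zero fun i _ => hscore i, smul_zero]
  have hscoreLim : ∑ j : QuadIdx p T K q, m j • fderiv ℝ (quadCoef j) lam₀ = 0 := by
    have h1 := tendsto_finsetSum (Finset.univ : Finset (QuadIdx p T K q)) fun j _ =>
      (hm j).smul_const (fderiv ℝ (quadCoef j) lam₀)
    simp only [hscoreN] at h1
    exact tendsto_nhds_unique h1 tendsto_const_nhds
  refine ⟨fun N ω lam hlam => ?_, fun N => ?_, hessComb m, fun lam hlam => ⟨fun a b => ?_, ?_⟩, ?_⟩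
  · rw [D.avgQll_eq_sum]
    exact contDiffAt_sum_quadCoef _ hlam
  · set G : QuadIdx p T K q → Param p T K q := fun j =>
      (InnerProductSpace.toDual ℝ (Param p T K q)).symm (fderiv ℝ (quadCoef j) lam₀) with hG
    have hgrad : ∀ ω, gradient (D.avgQll p T N ω) lam₀ = ∑ j, D.avgCross N ω j • G j := fun ω => by
      rw [gradient, D.avgQll_eq_sum, fderiv_sum_quadCoef _ hmem, map_sum]
      simp [hG]
    simp only [hgrad]
    refine ⟨integrable_finsetSum _ fun j _ => (hai N j).smul_const _, ?_⟩
    rw [integral_finsetSum _ fun j _ => (hai N j).smul_const _]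
    simp only [integral_smul_const, hae]
    have h1 := congrArg (InnerProductSpace.toDual ℝ (Param p T K q)).symm (hscoreN N)
    rw [map_sum, map_zero] at h1
    simpa [hG] using h1
  · simp only [D.avgHessian_eq _ _ hlam, hessComb, of_apply]
    refine ⟨fun N => integrable_finsetSum _ fun j _ => (hai N j).mul_const _, ?_⟩
    have h1 : ∀ N, ∫ ω, ∑ j, D.avgCross N ω j * fderiv ℝ (fderiv ℝ (quadCoef j)) lam
        (EuclideanSpace.single a 1) (EuclideanSpace.single b 1) ∂P =
        ∑ j, ((N : ℝ)⁻¹ * ∑ i ∈ Finset.range N, ∫ ω, D.cross j i ω ∂P) *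
          fderiv ℝ (fderiv ℝ (quadCoef j)) lam
            (EuclideanSpace.single a 1) (EuclideanSpace.single b 1) := fun N => by
      rw [integral_finsetSum _ fun j _ => (hai N j).mul_const _]
      simp only [integral_mul_const, hae]
    simp only [h1]
    exact tendsto_finsetSum _ fun j _ => (hm j).mul_const _
  · filter_upwards [hconv] with ω hω
    simp only [D.avgHessian_eq _ _ hlam]
    refine tendsto_pi_nhds.2 fun a => tendsto_pi_nhds.2 fun b => ?_
    simp only [hessComb, of_apply]
    exact tendsto_finsetSum _ fun j _ => (hω j).mul_const _
  · intro hH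
    have hstat : fderiv ℝ (fun lam => ∑ j, m j * quadCoef j lam) lam₀ = 0 := by
      rw [fderiv_sum_quadCoef m hmem, hscoreLim]
    obtain ⟨r₁, hr₁, hlt⟩ := exists_lt_on_closedBall (contDiffAt_sum_quadCoef m hmem) hstat
      (fderiv_fderiv_neg_of_posDef hmem hH)
    obtain ⟨r₂, hr₂, hsub⟩ := Metric.nhds_basis_closedBall.mem_iff.1
      (isOpen_paramSpace.mem_nhds hmem)
    set C : Set (Param p T K q) := Metric.closedBall lam₀ (min r₁ r₂) with hC
    have hr : 0 < min r₁ r₂ := lt_min hr₁ hr₂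
    have hCsub : C ⊆ ParamSpace p T K q :=
      (Metric.closedBall_subset_closedBall (min_le_right _ _)).trans hsub
    have hCc : IsCompact C := isCompact_closedBall _ _
    have hmemC : lam₀ ∈ C := Metric.mem_closedBall_self hr.le
    have hcont : ∀ j : QuadIdx p T K q, ContinuousOn (quadCoef j) C := fun j lam hlam =>
      (contDiffAt_quadCoef (hCsub hlam) j).continuousAt.continuousWithinAt
    -- one selection over `ℕ × Ω` serves all sample sizes at once
    obtain ⟨lamHat, hmeas, hhat⟩ := exists_measurable_argmax
      (f := fun (ω : ℕ × Ω) => D.avgQll p T ω.1 ω.2) (ι := ParamIdx p T K q)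
      (g := fun k lam => lam k) (fun k => by fun_prop) (fun x y h => by ext k; exact h k)
      hCc ⟨lam₀, hmemC⟩ (fun ω => by
        rw [D.avgQll_eq_sum]
        exact continuousOn_finsetSum _ fun j _ => continuousOn_const.mul (hcont j))
      (fun lam _ => by
        refine measurable_from_prod_countable_right fun N => ?_
        simp only [D.avgQll_eq_sum]
        exact Finset.measurable_fun_sum _ fun j _ => (ham N j).mul_const _)
    refine ⟨C, hCsub, hCc, mem_interior_iff_mem_nhds.2 (Metric.closedBall_mem_nhds _ hr),
      fun N ω => lamHat (N, ω), fun N => hmeas.comp measurable_prodMk_left,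
      fun N ω => hhat (N, ω), ?_⟩
    filter_upwards [hconv] with ω hω
    refine tendsto_argmax_of_tendsto_coeff hCc hcont hω (fun lam hlam hne => ?_)
      (fun N => (hhat (N, ω)).1) fun N => ?_
    · exact hlt lam (Metric.closedBall_subset_closedBall (min_le_left _ _) hlam) hne
    · have h1 := isMaxOn_iff.1 (hhat (N, ω)).2 lam₀ hmemC
      simpa only [D.avgQll_eq_sum] using h1

end
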